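/- **Definitions.** A polynomial $f\in\mathbb R[x_1,\dots,x_n]$ is a *circuit polynomial* with outer exponents $\alpha(0),\dots,\alpha(r)$ and inner exponent $\beta$ ($r\le n$) if $f=\sum_{j=0}^r f_{\alpha(j)}x^{\alpha(j)}+f_\beta x^\beta$ with $f_{\alpha(j)}>0$ and $f_\beta\in\mathbb R$, where the Newton polytope $\mathrm{New}(f)$ is a simplex with vertices $\alpha(0),\dots,\alpha(r)\in(2\mathbb N)^n$ and $\beta=\sum_j\lambda_j\alpha(j)$ with all $\lambda_j>0$ and $\sum_j\lambda_j=1$. An exponent is called even if it lies in $(2\mathbb N)^n$, and odd otherwise. $C_{n,2d}$ is the cone of polynomials of degree at most $2d$ that are sums $\sum_i\mu_if_i$ with $\mu_i\ge 0$ and nonnegative circuit polynomials $f_i$. A *boundary* nonnegative circuit polynomial of degree $2d$ is a nonnegative circuit polynomial $f$ with $\deg f=2d$ that lies on the boundary of $C_{n,2d}$, the boundary being taken in the space of polynomials supported on the circuit $\{\alpha(0),\dots,\alpha(r),\beta\}$. $f$ is *degenerate* if it has infinitely many real zeros and $\mathrm{New}(f)$ is not $n$-dimensional. Let $\overline f=x_0^{2d}f(x_1/x_0,\dots,x_n/x_0)$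 be the homogenization, $\mathcal V(f)\subset\mathbb R^n$ and $\mathcal V(\overline f)\subset\mathbb P^n(\mathbb R)$ the sets of real zeros, and call the zeros of $\overline f$ with $x_0=0$ the zeros at infinity. **Theorem.** Let $f$ be a boundary nonnegative circuit polynomial of degree $2d$ in $n$ variables with inner exponent $\beta$. (1) Let $n=2$. (i) If $f$ has a constant term and is not degenerate, then $|\mathcal V(f)|=4$ and $|\mathcal V(\overline f)|\in\{4,5,6\}$ if $\beta$ is even, and $|\mathcal V(f)|=2$ and $|\mathcal V(\overline f)|\in\{2,3,4\}$ if $\beta$ is odd. (ii) If $f$ has no constant term, then either $|\mathcal V(f)|=|\mathcal V(\overline f)|=\infty$, or else $|\mathcal V(f)|=5$ and $|\mathcal V(\overline f)|\in\{5,6,7\}$ if $\beta$ is even, and $|\mathcal V(f)|=3$ and $|\mathcal V(\overline f)|\in\{3,4,5\}$ if $\beta$ is odd. In both cases, if $\mathcal V(f)$ is finite, then $\overline f$ has at most $2$ zeros at infinity. Each of the listed values of $|\mathcal V(\overline f)|$ in (i) and (ii), including the infinite case of (ii) for each parity of $\beta$, occurs for some such $f$ (of some degree) with $2$-dimensional Newton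 polytope. (2) Let $n>2$. Then $|\mathcal V(\overline f)|$ is $|\mathcal V(f)|$ plus the number of zeros at infinity. If $f$ has a constant term, then $\overline f$ has at most $3$ or infinitely many zeros at infinity. If $f$ has no constant term, then $\overline f$ has at most $2$ zeros at infinity, or it has infinitely many zeros (infinitely many at infinity, or infinitely many coming from $\mathcal V(f)$). For every $n>2$ all cases occur, for some degree and with $\mathcal V(f)$ finite and $\mathrm{New}(f)$ $n$-dimensional: exactly $0,1,2,3$ or infinitely many zeros at infinity with a constant term, and exactly $0,1,2$ or infinitely many without a constant term. -/

import Mathlib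

open MvPolynomial

noncomputable section

namespace CircuitZeros

variable {n : ℕ}

/-- An exponent vector, viewed as a point of `ℝⁿ`. -/
def toPoint (a : Fin n →₀ ℕ) : Fin n → ℝ := fun i => (a i : ℝ)

/-- An exponent is even if all its entries are even. -/
def IsEvenExp (a : Fin n →₀ ℕ) : Prop := ∀ i, Even (a i)

/-- The Newton polytope: the convex hull of the support. -/
def newtonPolytope (f : MvPolynomial (Fin n) ℝ) : Set (Fin n → ℝ) :=
  convexHull ℝ (toPoint '' (f.support : Set (Fin n →₀ ℕ)))

/-- The Newton polytope is `n`-dimensional. -/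
def IsFullDim (f : MvPolynomial (Fin n) ℝ) : Prop :=
  affineSpan ℝ (newtonPolytope f) = ⊤

/-- `f` is nonnegative on `ℝⁿ`. -/
def IsNonneg (f : MvPolynomial (Fin n) ℝ) : Prop := ∀ x : Fin n → ℝ, 0 ≤ eval x f

/-- `f` is a circuit polynomial with outer exponents `α 0, …, α r` and inner exponent `β`. -/
structure IsCircuit (f : MvPolynomial (Fin n) ℝ) (r : ℕ) (α : Fin (r + 1) → Fin n →₀ ℕ)
    (β : Fin n →₀ ℕ) : Prop where
  r_le : r ≤ n
  form : ∃ (c : Fin (r + 1) → ℝ) (b : ℝ), (∀ j, 0 < c j) ∧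
    f = ∑ j, monomial (α j) (c j) + monomial β b
  even : ∀ j, IsEvenExp (α j)
  simplex : AffineIndependent ℝ (fun j => toPoint (α j))
  newton : newtonPolytope f = convexHull ℝ (Set.range fun j => toPoint (α j))
  inner : ∃ w : Fin (r + 1) → ℝ, (∀ j, 0 < w j) ∧ ∑ j, w j = 1 ∧
    toPoint β = ∑ j, w j • toPoint (α j)

/-- `f` is a circuit polynomial. -/
def IsCircuitPolynomial (f : MvPolynomial (Fin n) ℝ) : Prop :=
  ∃ (r : ℕ) (α : Fin (r + 1) → Fin n →₀ ℕ) (β : Fin n →₀ ℕ), IsCircuit f r α β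

/-- The cone `C_{n,2d}` of sums of nonnegative circuit polynomials of degree at most `2d`. -/
def sonc (n d : ℕ) : Set (MvPolynomial (Fin n) ℝ) :=
  {p | p.totalDegree ≤ 2 * d ∧ ∃ k : ℕ, 0 < k ∧
    ∃ (μ : Fin k → ℝ) (g : Fin k → MvPolynomial (Fin n) ℝ),
      (∀ i, 0 ≤ μ i) ∧ (∀ i, IsCircuitPolynomial (g i) ∧ IsNonneg (g i)) ∧
      p = ∑ i, μ i • g i}

/-- The polynomial with support in `A` and the given coefficients. -/
def ofCoeffs (A : Finset (Fin n →₀ ℕ)) (c : A → ℝ) : MvPolynomial (Fin n) ℝ :=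
  ∑ a : A, monomial (a : Fin n →₀ ℕ) (c a)

/-- `f` lies on the boundary of the cone `C_{n,2d}` inside the space `ℝ^A` of the polynomials
supported on `A`. -/
def OnSoncBoundary (d : ℕ) (A : Finset (Fin n →₀ ℕ)) (f : MvPolynomial (Fin n) ℝ) : Prop :=
  (fun a : A => coeff (a : Fin n →₀ ℕ) f) ∈ frontier {c : A → ℝ | ofCoeffs A c ∈ sonc n d}

/-- `f` is a nonnegative circuit polynomial of degree `2d`, with outer exponents `α` and inner
exponent `β`, on the boundary of the SONC cone; the boundary is taken among the polynomials
supported on the circuit `{α 0, …, α r, β}`. -/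
structure IsBoundaryCircuit (d : ℕ) (f : MvPolynomial (Fin n) ℝ) (r : ℕ)
    (α : Fin (r + 1) → Fin n →₀ ℕ) (β : Fin n →₀ ℕ) : Prop where
  circuit : IsCircuit f r α β
  nonneg : IsNonneg f
  degree : f.totalDegree = 2 * d
  boundary : OnSoncBoundary d (insert β (Finset.univ.image α)) f

/-- `f` has a constant term. -/
def HasConstantTerm (f : MvPolynomial (Fin n) ℝ) : Prop := coeff 0 f ≠ 0

/-- The real zeros of `f` in `ℝⁿ`. -/
def affineZeros (f : MvPolynomial (Fin n) ℝ) : Set (Fin n → ℝ) := {v | eval v f = 0}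

/-- `f` is degenerate if it has infinitely many zeros and its Newton polytope is not
full-dimensional. -/
def IsDegenerate (f : MvPolynomial (Fin n) ℝ) : Prop :=
  (affineZeros f).Infinite ∧ ¬ IsFullDim f

/-- The homogenization `x₀^{2d} f(x₁/x₀, …, xₙ/x₀)` of a polynomial of degree at most `2d`. -/
def homogenization (d : ℕ) (f : MvPolynomial (Fin n) ℝ) : MvPolynomial (Fin (n + 1)) ℝ :=
  ∑ a ∈ f.support, monomial (Finsupp.cons (2 * d - a.degree) a) (coeff a f)

/-- The zeros in real projective `n`-space of a form in `n + 1` variables. -/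
def projZeros (F : MvPolynomial (Fin (n + 1)) ℝ) : Set (Projectivization ℝ (Fin (n + 1) → ℝ)) :=
  {P | eval P.rep F = 0}

/-- The projective zeros with `v₀ = 0`. -/
def zerosAtInfinity (F : MvPolynomial (Fin (n + 1)) ℝ) :
    Set (Projectivization ℝ (Fin (n + 1) → ℝ)) :=
  {P | P ∈ projZeros F ∧ P.rep 0 = 0}

/-- A boundary nonnegative circuit polynomial in `n` variables with full-dimensional Newton
polytope, of some degree `2d`, has the property `Q d f β`. -/
def Occurs (n : ℕ) (Q : ℕ → MvPolynomial (Fin n) ℝ → (Fin n →₀ ℕ) → Prop) : Prop :=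
  ∃ (d : ℕ) (f : MvPolynomial (Fin n) ℝ) (r : ℕ) (α : Fin (r + 1) → Fin n →₀ ℕ)
    (β : Fin n →₀ ℕ), IsBoundaryCircuit d f r α β ∧ IsFullDim f ∧ Q d f β

end CircuitZeros

end

/-!
Let `Θ = ∏ (c_j / w_j) ^ w_j` be the circuit number of a circuit polynomial
`f = ∑ c_j x^{α(j)} + b x^β`, where `w` are the barycentric coordinates of `β`. By the weighted
AM–GM inequality `∑ c_j x^{α(j)} ≥ Θ |x^β|`, so `f` is nonnegative if and only if `Θ + b s ≥ 0` for
every sign `s` that `x^β` takes, and it is on the boundary of the cone if and only if equality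
holds for one of these signs.

Equality in AM–GM is a linear system for `log |x_i|`. When the simplex is full-dimensional, it has a
unique solution, so the zeros of `f` with nonzero coordinates are the reflections of one positive
point into the orthants on which `x^β` has the sign `s`. Otherwise, there is a whole line of
solutions. On the coordinate hyperplanes `x^β` vanishes, and a sum of nonnegative terms
`c_j x^{α(j)}` is zero only if each of them is: there are no such zeros if `f` has a constant term,
and if not, the origin is the only one exactly when every coordinate axis contains an `α(j)`.

At infinity, only the terms of degree `2d` remain, and `β` is not one of their exponents. If each
coordinate plane contains an `α(j)` of degree `2d`, the zeros at infinity are the coordinate points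
of the axes without such an exponent. For `s` such axes, the `s.choose 2` planes that they span and
the remaining axes need distinct exponents, which bounds `s`. Otherwise, some coordinate plane
contributes a line of zeros at infinity.
-/

noncomputable section

namespace CircuitZeros

section Affine

variable {n r : ℕ}

/-! ### Affine functions on a simplex -/

/-- The matrix with rows `(1, α j)`: it evaluates the affine function with coefficients `(h, l)`
at the points `α j`. -/
def liftedMatrix (α : Fin (r + 1) → Fin n →₀ ℕ) : Matrix (Fin (r + 1)) (Fin (n + 1)) ℝ :=
  Matrix.of fun j => Fin.cons 1 (toPoint (α j))

lemma liftedMatrix_mulVec (α : Fin (r + 1) → Fin n →₀ ℕ) (v : Fin (n + 1) → ℝ)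
    (j : Fin (r + 1)) :
    (liftedMatrix α).mulVec v j = v 0 + ∑ i, (α j i : ℝ) * v i.succ := by
  simp [liftedMatrix, Matrix.mulVec, dotProduct, Fin.sum_univ_succ, toPoint]

lemma affineIndependent_iff_forall_sum_mul_eq_zero {p : Fin (r + 1) → Fin n → ℝ} :
    AffineIndependent ℝ p ↔
      ∀ u : Fin (r + 1) → ℝ, ∑ j, u j = 0 → (∀ i, ∑ j, u j * p j i = 0) → u = 0 := by
  rw [affineIndependent_iff_of_fintype]
  refine forall_congr' fun u => forall_congr' fun hu => ?_
  rw [Finset.weightedVSub_eq_linear_combination _ hu]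
  simp [funext_iff]

variable {α : Fin (r + 1) → Fin n →₀ ℕ}

lemma linearIndependent_row_liftedMatrix
    (hα : AffineIndependent ℝ (fun j => toPoint (α j))) :
    LinearIndependent ℝ (liftedMatrix α).row := by
  rw [Fintype.linearIndependent_iff]
  intro u hu
  refine congrFun (affineIndependent_iff_forall_sum_mul_eq_zero.1 hα u ?_ fun i => ?_)
  · simpa [liftedMatrix, Matrix.row] using congrFun hu 0
  · simpa [liftedMatrix, Matrix.row, toPoint] using congrFun hu i.succ

lemma mulVecLin_liftedMatrix_surjective
    (hα : AffineIndependent ℝ (fun j => toPoint (α j))) :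
    Function.Surjective (liftedMatrix α).mulVecLin := by
  rw [← LinearMap.range_eq_top]
  apply Submodule.eq_top_of_finrank_eq
  simpa [Matrix.rank] using (linearIndependent_row_liftedMatrix hα).rank_matrix

lemma exists_affine_interpolation (hα : AffineIndependent ℝ (fun j => toPoint (α j)))
    (t : Fin (r + 1) → ℝ) :
    ∃ (h : ℝ) (l : Fin n → ℝ), ∀ j, h + ∑ i, (α j i : ℝ) * l i = t j := by
  obtain ⟨v, rfl⟩ := mulVecLin_liftedMatrix_surjective hα t
  exact ⟨v 0, Fin.tail v, fun j => (liftedMatrix_mulVec α v j).symm⟩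

lemma eq_zero_of_forall_sum_mul_eq {α : Fin (n + 1) → Fin n →₀ ℕ}
    (hα : AffineIndependent ℝ (fun j => toPoint (α j))) {l : Fin n → ℝ} {h : ℝ}
    (hl : ∀ j, ∑ i, (α j i : ℝ) * l i = h) : l = 0 := by
  have hinj := (LinearMap.injective_iff_surjective_of_finrank_eq_finrank (by simp)).2
    (mulVecLin_liftedMatrix_surjective hα)
  have hcons : (Fin.cons (-h) l : Fin (n + 1) → ℝ) = 0 := by
    refine (map_eq_zero_iff _ hinj).1 (funext fun j => ?_)
    rw [Matrix.mulVecLin_apply, liftedMatrix_mulVec]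
    simp [hl]
  exact funext fun i => congrFun hcons i.succ

lemma exists_ne_zero_forall_sum_mul_eq (hr : r < n) (α : Fin (r + 1) → Fin n →₀ ℕ) :
    ∃ (l : Fin n → ℝ) (h : ℝ), l ≠ 0 ∧ ∀ j, ∑ i, (α j i : ℝ) * l i = h := by
  have hker : (liftedMatrix α).mulVecLin.ker ≠ ⊥ :=
    LinearMap.ker_ne_bot_of_finrank_lt (by simpa using hr)
  obtain ⟨v, hv, hv0⟩ := Submodule.exists_mem_ne_zero_of_ne_bot hker
  have hconst : ∀ j, v 0 + ∑ i, (α j i : ℝ) * v i.succ = 0 := fun j => by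
    rw [← liftedMatrix_mulVec]
    exact congrFun (LinearMap.mem_ker.1 hv) j
  refine ⟨Fin.tail v, -v 0, fun htail => hv0 ?_, fun j => eq_neg_of_add_eq_zero_right (hconst j)⟩
  have hsucc : ∀ i, v (Fin.succ i) = 0 := congrFun htail
  exact funext <| Fin.cases (by simpa [hsucc] using hconst 0) hsucc

end Affine

section Monomials

variable {n : ℕ}

/-! ### Monomials and signs -/

/-- The monomial function `x ↦ x^a`. -/
def mon (a : Fin n →₀ ℕ) (x : Fin n → ℝ) : ℝ := ∏ i, x i ^ a i

lemma eval_monomial_eq_mul_mon (a : Fin n →₀ ℕ) (c : ℝ) (x : Fin n → ℝ) :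
    eval x (monomial a c) = c * mon a x := by
  rw [eval_monomial, Finsupp.prod_fintype _ _ (by simp), mon]

lemma mon_mul (a : Fin n →₀ ℕ) (x y : Fin n → ℝ) : mon a (x * y) = mon a x * mon a y := by
  simp [mon, mul_pow, Finset.prod_mul_distrib]

lemma mon_smul (a : Fin n →₀ ℕ) (t : ℝ) (x : Fin n → ℝ) :
    mon a (t • x) = t ^ a.degree * mon a x := by
  simp [mon, mul_pow, Finset.prod_mul_distrib, Finset.prod_pow_eq_pow_sum,
    Finsupp.degree_eq_sum]

lemma mon_eq_zero_iff {a : Fin n →₀ ℕ} {x : Fin n → ℝ} :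
    mon a x = 0 ↔ ∃ i, x i = 0 ∧ a i ≠ 0 := by
  simp [mon, Finset.prod_eq_zero_iff]

lemma mon_pos (a : Fin n →₀ ℕ) {x : Fin n → ℝ} (hx : ∀ i, 0 < x i) : 0 < mon a x :=
  Finset.prod_pos fun i _ => pow_pos (hx i) _

lemma mon_exp (a : Fin n →₀ ℕ) (l : Fin n → ℝ) :
    mon a (fun i => Real.exp (l i)) = Real.exp (∑ i, (a i : ℝ) * l i) := by
  simp [mon, Real.exp_sum, Real.exp_nat_mul]

lemma mon_nonneg_of_isEvenExp {a : Fin n →₀ ℕ} (ha : IsEvenExp a) (x : Fin n → ℝ) :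
    0 ≤ mon a x :=
  Finset.prod_nonneg fun i _ => (ha i).pow_nonneg _

/-- The sign of the monomial `x^a` on the orthant with sign vector `s`. -/
def signMon (a : Fin n →₀ ℕ) : (Fin n → ℤˣ) →* ℤˣ where
  toFun s := ∏ i, s i ^ a i
  map_one' := by simp
  map_mul' s t := by simp [mul_pow, Finset.prod_mul_distrib]

lemma signMon_apply (a : Fin n →₀ ℕ) (s : Fin n → ℤˣ) : signMon a s = ∏ i, s i ^ a i := rfl

/-- The real vector with the signs `s` and the absolute values `y`. -/
def signed (s : Fin n → ℤˣ) (y : Fin n → ℝ) : Fin n → ℝ := fun i => ((s i : ℤ) : ℝ) * y i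

lemma signed_eq_zero_iff {s : Fin n → ℤˣ} {y : Fin n → ℝ} {i : Fin n} :
    signed s y i = 0 ↔ y i = 0 := by
  simp [signed]

lemma mon_signed (a : Fin n →₀ ℕ) (s : Fin n → ℤˣ) (y : Fin n → ℝ) :
    mon a (signed s y) = ((signMon a s : ℤ) : ℝ) * mon a y := by
  simp [mon, signed, signMon, mul_pow, Finset.prod_mul_distrib]

lemma exists_signed_abs (x : Fin n → ℝ) : ∃ s, signed s |x| = x := by
  refine ⟨fun i => if 0 ≤ x i then 1 else -1, funext fun i => ?_⟩
  by_cases hi : 0 ≤ x i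
  · simp [signed, hi]
  · simp [signed, hi, abs_of_neg (not_le.1 hi)]

lemma signed_left_injective {y : Fin n → ℝ} (hy : ∀ i, 0 < y i) :
    Function.Injective fun s => signed s y := fun s t hst => funext fun i => by
  simpa [signed, (hy i).ne', Units.ext_iff] using congrFun hst i

lemma signMon_of_isEvenExp {a : Fin n →₀ ℕ} (ha : IsEvenExp a) (s : Fin n → ℤˣ) :
    signMon a s = 1 := by
  refine (signMon_apply a s).trans (Finset.prod_eq_one fun i _ => ?_)
  obtain ⟨k, hk⟩ := ha i
  rw [hk, ← two_mul, pow_mul, Int.units_sq, one_pow]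

lemma signMon_surjective {a : Fin n →₀ ℕ} (ha : ¬ IsEvenExp a) :
    Function.Surjective (signMon a) := by
  simp only [IsEvenExp, not_forall, Nat.not_even_iff_odd] at ha
  obtain ⟨i, hi⟩ := ha
  have hneg : signMon a (Pi.mulSingle i (-1)) = -1 := by
    rw [signMon_apply, Finset.prod_eq_single i (fun k _ hk => by simp [hk]) (by simp)]
    simp [hi.neg_one_pow]
  intro ε
  obtain rfl | rfl := Int.units_eq_one_or ε
  exacts [⟨1, map_one _⟩, ⟨_, hneg⟩]

open Classical in
/-- The number of orthants of `ℝⁿ` on which the monomial `x^a` has a given sign, provided that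
this sign is attained. -/
def orthantCount (a : Fin n →₀ ℕ) : ℕ := if IsEvenExp a then 2 ^ n else 2 ^ (n - 1)

lemma card_ker_signMon (a : Fin n →₀ ℕ) : Nat.card (signMon a).ker = orthantCount a := by
  have hcard : Nat.card (Fin n → ℤˣ) = 2 ^ n := by simp
  by_cases ha : IsEvenExp a
  · have hker : (signMon a).ker = ⊤ :=
      (Subgroup.eq_top_iff' _).2 fun s => signMon_of_isEvenExp ha s
    rw [orthantCount, if_pos ha, hker, Subgroup.card_top, hcard]
  · have hn : n ≠ 0 := by
      rintro rfl
      exact ha finZeroElim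
    have hmul := (signMon a).ker.card_mul_index
    rw [Subgroup.index_ker, MonoidHom.range_eq_top.2 (signMon_surjective ha), Subgroup.card_top,
      hcard, ← pow_sub_one_mul hn] at hmul
    rw [orthantCount, if_neg ha]
    simpa using hmul

lemma encard_signMon_eq (a : Fin n →₀ ℕ) (s : Fin n → ℤˣ) :
    {t | signMon a t = signMon a s}.encard = orthantCount a := by
  have hcoset : {t | signMon a t = signMon a s} = (s * ·) '' ((signMon a).ker : Set _) := by
    ext t
    rw [Set.image_mul_left, Set.mem_preimage, SetLike.mem_coe, MonoidHom.mem_ker, map_mul,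
      map_inv, inv_mul_eq_one, eq_comm, Set.mem_ofPred_eq]
  rw [hcoset, (mul_right_injective s).encard_image, ← card_ker_signMon,
    ← (Set.toFinite _).cast_ncard_eq]
  rfl

end Monomials

section InnerPoint

variable {n r : ℕ}

/-! ### Circuits and the circuit number -/

/-- `α` are the vertices of an even simplex of positive dimension and `β` is its interior point
with barycentric coordinates `w`. -/
structure IsInnerPoint (α : Fin (r + 1) → Fin n →₀ ℕ) (β : Fin n →₀ ℕ)
    (w : Fin (r + 1) → ℝ) : Prop where
  r_pos : 0 < r
  even : ∀ j, IsEvenExp (α j)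
  simplex : AffineIndependent ℝ (fun j => toPoint (α j))
  pos : ∀ j, 0 < w j
  sum : ∑ j, w j = 1
  bary : ∀ i, (β i : ℝ) = ∑ j, w j * α j i

/-- The polynomial `∑ c_j x^{α(j)} + b x^β`. -/
def circuitPoly (α : Fin (r + 1) → Fin n →₀ ℕ) (β : Fin n →₀ ℕ) (c : Fin (r + 1) → ℝ) (b : ℝ) :
    MvPolynomial (Fin n) ℝ :=
  ∑ j, monomial (α j) (c j) + monomial β b

/-- The circuit number `∏ (c_j / w_j)^{w_j}`: by the weighted AM-GM inequality it is the largest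
`Θ` with `Θ |x^β| ≤ ∑ c_j x^{α(j)}` for all `x`. -/
def circuitNumber (w c : Fin (r + 1) → ℝ) : ℝ := ∏ j, (c j / w j) ^ w j

/-- Equality in the weighted AM-GM inequality holds at `x`. -/
def IsBalanced (α : Fin (r + 1) → Fin n →₀ ℕ) (w c : Fin (r + 1) → ℝ) (x : Fin n → ℝ) : Prop :=
  ∀ j k, c j / w j * mon (α j) x = c k / w k * mon (α k) x

variable {α : Fin (r + 1) → Fin n →₀ ℕ} {β : Fin n →₀ ℕ} {w c : Fin (r + 1) → ℝ} {b : ℝ}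

lemma eval_circuitPoly (c : Fin (r + 1) → ℝ) (b : ℝ) (x : Fin n → ℝ) :
    eval x (circuitPoly α β c b) = ∑ j, c j * mon (α j) x + b * mon β x := by
  simp [circuitPoly, eval_monomial_eq_mul_mon]

lemma eq_or_exists_eq_of_mem_support {a : Fin n →₀ ℕ}
    (ha : a ∈ (circuitPoly α β c b).support) : a = β ∨ ∃ j, a = α j := by
  classical
  contrapose! ha
  simp [circuitPoly, coeff_sum, coeff_monomial, ha.1.symm, fun j => (ha.2 j).symm]

lemma circuitNumber_pos (hw : ∀ j, 0 < w j) (hc : ∀ j, 0 < c j) : 0 < circuitNumber w c :=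
  Finset.prod_pos fun j _ => Real.rpow_pos_of_pos (div_pos (hc j) (hw j)) _

lemma continuousAt_circuitNumber (hw : ∀ j, 0 < w j) (hc : ∀ j, 0 < c j) :
    ContinuousAt (circuitNumber w) c :=
  tendsto_finsetProd _ fun j _ =>
    have hdiv : ContinuousAt (fun c : Fin (r + 1) → ℝ => c j / w j) c :=
      ((continuous_apply j).div_const _).continuousAt
    hdiv.rpow_const (.inl (div_pos (hc j) (hw j)).ne')

lemma mon_signed_of_isEvenExp {a : Fin n →₀ ℕ} (ha : IsEvenExp a) (s : Fin n → ℤˣ)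
    (y : Fin n → ℝ) : mon a (signed s y) = mon a y := by
  simp [mon_signed, signMon_of_isEvenExp ha]

namespace IsInnerPoint

lemma ne_beta (h : IsInnerPoint α β w) (k : Fin (r + 1)) : α k ≠ β := by
  rintro rfl
  have hw := affineIndependent_iff_forall_sum_mul_eq_zero.1 h.simplex (w - Pi.single k 1)
    (by simp [h.sum]) fun i => by simp [toPoint, sub_mul, ← h.bary i, Pi.single_apply]
  have : Nontrivial (Fin (r + 1)) := Fin.nontrivial_iff_two_le.2 (by have := h.r_pos; lia)
  obtain ⟨j, hj⟩ := exists_ne k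
  have hwj : w j = 0 := by simpa [hj] using congrFun hw j
  exact (h.pos j).ne' hwj

lemma injective (h : IsInnerPoint α β w) : Function.Injective α :=
  .of_comp (f := toPoint) h.simplex.injective

lemma coeff_alpha (h : IsInnerPoint α β w) (c : Fin (r + 1) → ℝ) (b : ℝ) (k : Fin (r + 1)) :
    coeff (α k) (circuitPoly α β c b) = c k := by
  classical
  simp [circuitPoly, coeff_sum, coeff_monomial, h.injective.eq_iff, (h.ne_beta k).symm]

lemma coeff_beta (h : IsInnerPoint α β w) (c : Fin (r + 1) → ℝ) (b : ℝ) :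
    coeff β (circuitPoly α β c b) = b := by
  classical
  simp [circuitPoly, coeff_sum, coeff_monomial, h.ne_beta]

lemma alpha_mem_support (h : IsInnerPoint α β w) (hc : ∀ j, 0 < c j) (j : Fin (r + 1)) :
    α j ∈ (circuitPoly α β c b).support := by
  rw [mem_support_iff, h.coeff_alpha]
  exact (hc j).ne'

lemma toPoint_beta (h : IsInnerPoint α β w) : toPoint β = ∑ j, w j • toPoint (α j) := by
  funext i
  simp [toPoint, h.bary i]

lemma newtonPolytope_eq (h : IsInnerPoint α β w) (hc : ∀ j, 0 < c j) (b : ℝ) :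
    newtonPolytope (circuitPoly α β c b) = convexHull ℝ (Set.range fun j => toPoint (α j)) := by
  apply Set.Subset.antisymm
  · apply convexHull_min _ (convex_convexHull ℝ _)
    rintro _ ⟨a, ha, rfl⟩
    rcases eq_or_exists_eq_of_mem_support ha with rfl | ⟨j, rfl⟩
    · rw [h.toPoint_beta]
      exact (convex_convexHull ℝ _).sum_mem (fun j _ => (h.pos j).le) h.sum
        fun j _ => subset_convexHull ℝ _ ⟨j, rfl⟩
    · exact subset_convexHull ℝ _ ⟨j, rfl⟩
  · apply convexHull_mono
    rintro _ ⟨j, rfl⟩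
    exact ⟨α j, h.alpha_mem_support hc j, rfl⟩

lemma r_le (h : IsInnerPoint α β w) : r ≤ n := by
  have hcard := h.simplex.card_le_finrank_succ
  have hfin := (vectorSpan ℝ (Set.range fun j => toPoint (α j))).finrank_le
  simp only [Fintype.card_fin, Module.finrank_fintype_fun_eq_card] at hcard hfin
  lia

lemma isCircuit (h : IsInnerPoint α β w) (hc : ∀ j, 0 < c j) (b : ℝ) :
    IsCircuit (circuitPoly α β c b) r α β where
  r_le := h.r_le
  form := ⟨c, b, hc, rfl⟩
  even := h.even
  simplex := h.simplex
  newton := h.newtonPolytope_eq hc b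
  inner := ⟨w, h.pos, h.sum, h.toPoint_beta⟩

lemma degree_beta (h : IsInnerPoint α β w) : (β.degree : ℝ) = ∑ j, w j * (α j).degree := by
  simp only [Finsupp.degree_eq_sum, Nat.cast_sum, h.bary, Finset.mul_sum]
  exact Finset.sum_comm

lemma degree_beta_le (h : IsInnerPoint α β w) {D : ℕ} (hD : ∀ j, (α j).degree ≤ D) :
    β.degree ≤ D := by
  rw [← Nat.cast_le (α := ℝ), h.degree_beta, ← one_mul (D : ℝ), ← h.sum, Finset.sum_mul]
  gcongr with j
  exacts [(h.pos j).le, hD j]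

lemma degree_beta_lt (h : IsInnerPoint α β w) {D : ℕ} (hD : ∀ j, (α j).degree ≤ D)
    {k : Fin (r + 1)} (hk : (α k).degree < D) : β.degree < D := by
  rw [← Nat.cast_lt (α := ℝ), h.degree_beta, ← one_mul (D : ℝ), ← h.sum, Finset.sum_mul]
  refine Finset.sum_lt_sum (fun j _ => ?_) ⟨k, Finset.mem_univ k, ?_⟩
  · exact mul_le_mul_of_nonneg_left (by exact_mod_cast hD j) (h.pos j).le
  · exact mul_lt_mul_of_pos_left (by exact_mod_cast hk) (h.pos k)

lemma totalDegree_le (h : IsInnerPoint α β w) {D : ℕ} (hD : ∀ j, (α j).degree ≤ D)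
    (c : Fin (r + 1) → ℝ) (b : ℝ) : (circuitPoly α β c b).totalDegree ≤ D := by
  refine Finset.sup_le fun a ha => ?_
  rcases eq_or_exists_eq_of_mem_support ha with rfl | ⟨j, rfl⟩
  exacts [h.degree_beta_le hD, hD j]

lemma alpha_eq_zero_of_beta_eq_zero (h : IsInnerPoint α β w) {i : Fin n} (hi : β i = 0)
    (j : Fin (r + 1)) : α j i = 0 := by
  have hbary := h.bary i
  rw [hi, Nat.cast_zero, eq_comm, Finset.sum_eq_zero_iff_of_nonneg
    (fun j _ => mul_nonneg (h.pos j).le (Nat.cast_nonneg _))] at hbary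
  simpa [(h.pos j).ne'] using hbary j (Finset.mem_univ j)

lemma prod_mon_rpow (h : IsInnerPoint α β w) {y : Fin n → ℝ} (hy : ∀ i, 0 ≤ y i) :
    ∏ j, mon (α j) y ^ w j = mon β y := by
  have hrpow : ∀ j, mon (α j) y ^ w j = ∏ i, y i ^ (w j * α j i) := fun j => by
    rw [mon, ← Real.finsetProd_rpow _ _ fun i _ => pow_nonneg (hy i) _]
    refine Finset.prod_congr rfl fun i _ => ?_
    rw [mul_comm, Real.rpow_mul (hy i), Real.rpow_natCast]
  simp only [hrpow]
  rw [Finset.prod_comm, mon]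
  refine Finset.prod_congr rfl fun i _ => ?_
  rw [← Real.rpow_sum_of_nonneg (hy i) fun j _ => mul_nonneg (h.pos j).le (Nat.cast_nonneg _),
    ← h.bary i, Real.rpow_natCast]

lemma prod_weighted_mon_rpow (h : IsInnerPoint α β w) (hc : ∀ j, 0 < c j) {y : Fin n → ℝ}
    (hy : ∀ i, 0 ≤ y i) :
    ∏ j, (c j / w j * mon (α j) y) ^ w j = circuitNumber w c * mon β y := by
  rw [← h.prod_mon_rpow hy, circuitNumber, ← Finset.prod_mul_distrib]
  exact Finset.prod_congr rfl fun j _ => Real.mul_rpow (div_pos (hc j) (h.pos j)).le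
    (mon_nonneg_of_isEvenExp (h.even j) y)

lemma sum_weighted_mon (h : IsInnerPoint α β w) (c : Fin (r + 1) → ℝ) (y : Fin n → ℝ) :
    ∑ j, w j * (c j / w j * mon (α j) y) = ∑ j, c j * mon (α j) y :=
  Finset.sum_congr rfl fun j _ => by rw [← mul_assoc, mul_div_cancel₀ _ (h.pos j).ne']

lemma circuitNumber_mul_mon_le (h : IsInnerPoint α β w) (hc : ∀ j, 0 < c j) {y : Fin n → ℝ}
    (hy : ∀ i, 0 ≤ y i) : circuitNumber w c * mon β y ≤ ∑ j, c j * mon (α j) y := by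
  rw [← h.prod_weighted_mon_rpow hc hy, ← h.sum_weighted_mon]
  exact Real.geom_mean_le_arith_mean_weighted _ _ _ (fun j _ => (h.pos j).le) h.sum fun j _ =>
    mul_nonneg (div_pos (hc j) (h.pos j)).le (mon_nonneg_of_isEvenExp (h.even j) y)

lemma circuitNumber_mul_mon_eq_iff (h : IsInnerPoint α β w) (hc : ∀ j, 0 < c j)
    {y : Fin n → ℝ} (hy : ∀ i, 0 ≤ y i) :
    circuitNumber w c * mon β y = ∑ j, c j * mon (α j) y ↔ IsBalanced α w c y := by
  rw [← h.prod_weighted_mon_rpow hc hy, ← h.sum_weighted_mon,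
    Real.geom_mean_eq_arith_mean_weighted_iff_of_pos _ _ _ (fun j _ => h.pos j) h.sum fun j _ =>
      mul_nonneg (div_pos (hc j) (h.pos j)).le (mon_nonneg_of_isEvenExp (h.even j) y)]
  simp [IsBalanced]

lemma exists_isBalanced (h : IsInnerPoint α β w) (hc : ∀ j, 0 < c j) :
    ∃ p : Fin n → ℝ, (∀ i, 0 < p i) ∧ IsBalanced α w c p := by
  obtain ⟨s, l, hl⟩ := exists_affine_interpolation h.simplex fun j => -Real.log (c j / w j)
  have hval : ∀ j, c j / w j * mon (α j) (fun i => Real.exp (l i)) = Real.exp (-s) := fun j => by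
    rw [mon_exp, ← Real.exp_log (div_pos (hc j) (h.pos j)), ← Real.exp_add]
    congr 1
    linarith [hl j]
  exact ⟨_, fun i => Real.exp_pos _, fun j k => (hval j).trans (hval k).symm⟩

lemma eval_signed (h : IsInnerPoint α β w) (c : Fin (r + 1) → ℝ) (b : ℝ) (s : Fin n → ℤˣ)
    (y : Fin n → ℝ) :
    eval (signed s y) (circuitPoly α β c b) =
      (∑ j, c j * mon (α j) y - circuitNumber w c * mon β y) +
        (circuitNumber w c + b * (signMon β s : ℤ)) * mon β y := by
  simp only [eval_circuitPoly, mon_signed_of_isEvenExp (h.even _), mon_signed β]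
  ring

lemma isNonneg_iff (h : IsInnerPoint α β w) (hc : ∀ j, 0 < c j) :
    IsNonneg (circuitPoly α β c b) ↔ ∀ s, 0 ≤ circuitNumber w c + b * (signMon β s : ℤ) := by
  constructor
  · intro hnonneg s
    obtain ⟨p, hp, hbal⟩ := h.exists_isBalanced hc
    have heval := hnonneg (signed s p)
    rw [h.eval_signed, (h.circuitNumber_mul_mon_eq_iff hc fun i => (hp i).le).2 hbal, sub_self,
      zero_add] at heval
    exact nonneg_of_mul_nonneg_left heval (mon_pos β hp)
  · intro hsign x
    obtain ⟨s, hs⟩ := exists_signed_abs x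
    rw [← hs, h.eval_signed]
    have hy : ∀ i, 0 ≤ |x| i := fun i => abs_nonneg (x i)
    have hmon : 0 ≤ mon β |x| := Finset.prod_nonneg fun i _ => pow_nonneg (hy i) _
    exact add_nonneg (sub_nonneg.2 (h.circuitNumber_mul_mon_le hc hy)) (mul_nonneg (hsign s) hmon)

end IsInnerPoint

lemma IsCircuit.exists_isInnerPoint {f : MvPolynomial (Fin n) ℝ} (hf : IsCircuit f r α β)
    (hr : 0 < r) :
    ∃ (w c : Fin (r + 1) → ℝ) (b : ℝ), IsInnerPoint α β w ∧ (∀ j, 0 < c j) ∧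
      f = circuitPoly α β c b := by
  obtain ⟨c, b, hc, hfc⟩ := hf.form
  obtain ⟨w, hw, hsum, hβ⟩ := hf.inner
  refine ⟨w, c, b, ⟨hr, hf.even, hf.simplex, hw, hsum, fun i => ?_⟩, hc, hfc⟩
  simpa [toPoint] using congrFun hβ i

end InnerPoint

section SoncBoundary

variable {n r d : ℕ}

/-! ### The boundary of the SONC cone -/

lemma IsCircuitPolynomial.mem_sonc {f : MvPolynomial (Fin n) ℝ} (hf : IsCircuitPolynomial f)
    (hnonneg : IsNonneg f) (hdeg : f.totalDegree ≤ 2 * d) : f ∈ sonc n d :=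
  ⟨hdeg, 1, one_pos, fun _ => 1, fun _ => f, fun _ => zero_le_one, fun _ => ⟨hf, hnonneg⟩, by simp⟩

lemma isNonneg_of_mem_sonc {f : MvPolynomial (Fin n) ℝ} (hf : f ∈ sonc n d) : IsNonneg f := by
  obtain ⟨-, k, -, μ, g, hμ, hg, rfl⟩ := hf
  intro x
  simp only [map_sum, smul_eval]
  exact Finset.sum_nonneg fun i _ => mul_nonneg (hμ i) ((hg i).2 x)

lemma ofCoeffs_eq_sum (A : Finset (Fin n →₀ ℕ)) (e : (Fin n →₀ ℕ) → ℝ) :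
    ofCoeffs A (fun a => e a) = ∑ a ∈ A, monomial a (e a) :=
  A.sum_coe_sort fun a => monomial a (e a)

lemma ofCoeffs_coeff {A : Finset (Fin n →₀ ℕ)} {f : MvPolynomial (Fin n) ℝ}
    (hA : f.support ⊆ A) : ofCoeffs A (fun a => coeff a f) = f := by
  refine (ofCoeffs_eq_sum A fun a => coeff a f).trans ?_
  rw [← Finset.sum_subset hA fun a _ ha => by rw [notMem_support_iff.1 ha, map_zero]]
  exact f.support_sum_monomial_coeff

lemma exists_extension (A : Finset (Fin n →₀ ℕ)) (v : A → ℝ) :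
    ∃ e : (Fin n →₀ ℕ) → ℝ, v = fun a : A => e a :=
  ⟨Function.extend Subtype.val v 0, funext fun a => (Subtype.val_injective.extend_apply v 0 a).symm⟩

/-- The exponents of a circuit. -/
abbrev circuitExps (α : Fin (r + 1) → Fin n →₀ ℕ) (β : Fin n →₀ ℕ) : Finset (Fin n →₀ ℕ) :=
  insert β (Finset.univ.image α)

/-- The inner exponent as an element of the circuit. -/
def innerExp (α : Fin (r + 1) → Fin n →₀ ℕ) (β : Fin n →₀ ℕ) : circuitExps α β :=
  ⟨β, Finset.mem_insert_self _ _⟩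

/-- An outer exponent as an element of the circuit. -/
def outerExp (α : Fin (r + 1) → Fin n →₀ ℕ) (β : Fin n →₀ ℕ) (j : Fin (r + 1)) :
    circuitExps α β :=
  ⟨α j, Finset.mem_insert_of_mem (Finset.mem_image_of_mem _ (Finset.mem_univ j))⟩

lemma eventually_zero_lt_add_mul {X : Type*} [TopologicalSpace X] {Θ b : X → ℝ} {x : X}
    (hΘ : ContinuousAt Θ x) (hb : ContinuousAt b x) (a : Fin n →₀ ℕ)
    (h : ∀ s, 0 < Θ x + b x * (signMon a s : ℤ)) :
    ∀ᶠ y in nhds x, ∀ s, 0 < Θ y + b y * (signMon a s : ℤ) :=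
  Filter.eventually_all.2 fun s => (hΘ.add (hb.mul_const _)).eventually_const_lt (h s)

variable {α : Fin (r + 1) → Fin n →₀ ℕ} {β : Fin n →₀ ℕ} {w c : Fin (r + 1) → ℝ} {b : ℝ}
  {f : MvPolynomial (Fin n) ℝ}

lemma IsBoundaryCircuit.not_eventually_mem_sonc (hf : IsBoundaryCircuit d f r α β) :
    ¬ ∀ᶠ v in nhds (fun a : circuitExps α β => coeff (a : Fin n →₀ ℕ) f),
      ofCoeffs (circuitExps α β) v ∈ sonc n d :=
  fun h => hf.boundary.2 (mem_interior_iff_mem_nhds.2 h)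

namespace IsInnerPoint

lemma ofCoeffs_circuitExps (h : IsInnerPoint α β w) (v : circuitExps α β → ℝ) :
    ofCoeffs (circuitExps α β) v =
      circuitPoly α β (fun j => v (outerExp α β j)) (v (innerExp α β)) := by
  obtain ⟨e, rfl⟩ := exists_extension _ v
  rw [ofCoeffs_eq_sum, Finset.sum_insert (by simp [h.ne_beta]),
    Finset.sum_image fun j _ k _ hjk => h.injective hjk, add_comm]
  rfl

/-- The circuit number is continuous in `c > 0`, so strict inequalities persist nearby. -/
lemma eventually_mem_sonc (h : IsInnerPoint α β w) (hc : ∀ j, 0 < c j)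
    (hdeg : ∀ j, (α j).degree ≤ 2 * d)
    (hb : ∀ s, 0 < circuitNumber w c + b * (signMon β s : ℤ)) :
    ∀ᶠ v in nhds (fun a : circuitExps α β => coeff (a : Fin n →₀ ℕ) (circuitPoly α β c b)),
      ofCoeffs (circuitExps α β) v ∈ sonc n d := by
  set v₀ := fun a : circuitExps α β => coeff (a : Fin n →₀ ℕ) (circuitPoly α β c b)
  have houter : (fun j => v₀ (outerExp α β j)) = c := funext (h.coeff_alpha c b)
  have hinner : v₀ (innerExp α β) = b := h.coeff_beta c b
  have hcont : Continuous fun (v : circuitExps α β → ℝ) j => v (outerExp α β j) := by fun_prop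
  have hpos : ∀ᶠ v in nhds v₀, ∀ j, 0 < v (outerExp α β j) :=
    Filter.eventually_all.2 fun j => (continuous_apply _).continuousAt.eventually_const_lt <| by
      simpa only [← houter] using hc j
  have hΘ : ContinuousAt (fun v => circuitNumber w fun j => v (outerExp α β j)) v₀ :=
    (continuousAt_circuitNumber h.pos hc).comp_of_eq hcont.continuousAt houter
  filter_upwards [hpos, eventually_zero_lt_add_mul hΘ
    (continuous_apply (innerExp α β)).continuousAt β (by simpa only [houter, hinner] using hb)]
    with v hv hsign
  rw [h.ofCoeffs_circuitExps]
  exact IsCircuitPolynomial.mem_sonc ⟨r, α, β, h.isCircuit hv _⟩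
    ((h.isNonneg_iff hv).2 fun s => (hsign s).le) (h.totalDegree_le hdeg _ _)

lemma exists_add_mul_eq_zero (h : IsInnerPoint α β w) (hc : ∀ j, 0 < c j)
    (hf : IsBoundaryCircuit d (circuitPoly α β c b) r α β) :
    ∃ s, circuitNumber w c + b * (signMon β s : ℤ) = 0 := by
  have hdeg : ∀ j, (α j).degree ≤ 2 * d := fun j =>
    hf.degree ▸ le_totalDegree (h.alpha_mem_support hc j)
  by_contra! hne
  exact hf.not_eventually_mem_sonc <| h.eventually_mem_sonc hc hdeg fun s =>
    ((h.isNonneg_iff hc).1 hf.nonneg s).lt_of_ne' (hne s)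

lemma not_eventually_mem_sonc (h : IsInnerPoint α β w) (hc : ∀ j, 0 < c j) :
    ¬ ∀ᶠ v in nhds (fun a : circuitExps α β =>
        coeff (a : Fin n →₀ ℕ) (circuitPoly α β c (-circuitNumber w c))),
      ofCoeffs (circuitExps α β) v ∈ sonc n d := by
  set v₀ := fun a : circuitExps α β =>
    coeff (a : Fin n →₀ ℕ) (circuitPoly α β c (-circuitNumber w c))
  intro hev
  set v : ℝ → circuitExps α β → ℝ := fun t => v₀ - t • Pi.single (innerExp α β) 1
  have hv : Continuous v := by fun_prop
  have hpath : ∀ᶠ t in nhds (0 : ℝ), ofCoeffs (circuitExps α β) (v t) ∈ sonc n d :=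
    (hv.tendsto' 0 v₀ (by simp [v])).eventually hev
  obtain ⟨t, hmem, ht⟩ :=
    ((hpath.filter_mono nhdsWithin_le_nhds).and (self_mem_nhdsWithin (s := Set.Ioi 0))).exists
  have houter : (fun j => v t (outerExp α β j)) = c := funext fun j => by
    have hne : outerExp α β j ≠ innerExp α β := fun he => h.ne_beta j (congrArg Subtype.val he)
    have hkeep : v t (outerExp α β j) = v₀ (outerExp α β j) := by simp [v, hne]
    exact hkeep.trans (h.coeff_alpha c _ j)
  have hinner : v t (innerExp α β) = -circuitNumber w c - t := by
    have hv₀ : v₀ (innerExp α β) = -circuitNumber w c := h.coeff_beta c _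
    simp [v, hv₀]
  have hnonneg := isNonneg_of_mem_sonc hmem
  rw [h.ofCoeffs_circuitExps, houter, hinner, h.isNonneg_iff hc] at hnonneg
  have hone := hnonneg 1
  simp only [map_one, Units.val_one, Int.cast_one, mul_one] at hone
  linarith

lemma isBoundaryCircuit (h : IsInnerPoint α β w) (hc : ∀ j, 0 < c j)
    (hdeg : ∀ j, (α j).degree ≤ 2 * d) {k : Fin (r + 1)} (hk : (α k).degree = 2 * d) :
    IsBoundaryCircuit d (circuitPoly α β c (-circuitNumber w c)) r α β := by
  have hcircuit := h.isCircuit hc (-circuitNumber w c)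
  have hnonneg : IsNonneg (circuitPoly α β c (-circuitNumber w c)) :=
    (h.isNonneg_iff hc).2 fun s => by
      have hΘ := circuitNumber_pos h.pos hc
      obtain hs | hs := Int.units_eq_one_or (signMon β s) <;> simp [hs, hΘ.le]
  have htotal := h.totalDegree_le hdeg c (-circuitNumber w c)
  refine ⟨hcircuit, hnonneg, htotal.antisymm ?_, subset_closure ?_, fun hint =>
    h.not_eventually_mem_sonc hc (mem_interior_iff_mem_nhds.1 hint)⟩
  · exact hk ▸ le_totalDegree (h.alpha_mem_support hc k)
  · rw [Set.mem_ofPred_eq, ofCoeffs_coeff fun a ha => ?_]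
    · exact IsCircuitPolynomial.mem_sonc ⟨r, α, β, hcircuit⟩ hnonneg htotal
    · rcases eq_or_exists_eq_of_mem_support ha with rfl | ⟨j, rfl⟩
      exacts [(innerExp α _).2, (outerExp α β j).2]

end IsInnerPoint

/-! ### Monomial squares -/

lemma isCircuit_monomial {β : Fin n →₀ ℕ} (hβ : IsEvenExp β) {a : ℝ} (ha : 0 < a) :
    IsCircuit (monomial β a) 0 (fun _ => β) β where
  r_le := n.zero_le
  form := ⟨fun _ => a / 2, a / 2, fun _ => half_pos ha, by simp [← map_add]⟩
  even _ := hβ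
  simplex := affineIndependent_of_subsingleton (ι := Fin 1) ℝ _
  newton := by
    rw [newtonPolytope, support_monomial, if_neg ha.ne']
    simp [Set.range_unique]
  inner := ⟨fun _ => 1, fun _ => one_pos, by simp, by simp⟩

lemma monomial_mem_sonc {β : Fin n →₀ ℕ} (hβ : IsEvenExp β) (hdeg : β.degree ≤ 2 * d) {a : ℝ}
    (ha : 0 < a) : monomial β a ∈ sonc n d :=
  IsCircuitPolynomial.mem_sonc ⟨0, _, β, isCircuit_monomial hβ ha⟩
    (fun x => by
      rw [eval_monomial_eq_mul_mon]
      exact mul_nonneg ha.le (mon_nonneg_of_isEvenExp hβ x))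
    ((totalDegree_monomial β ha.ne').trans_le hdeg)

lemma IsCircuit.eq_const_of_zero {α : Fin (0 + 1) → Fin n →₀ ℕ} (hf : IsCircuit f 0 α β) :
    α = fun _ => β := by
  obtain ⟨w, -, hw, hβ⟩ := hf.inner
  have hw0 : w 0 = 1 := by simpa using hw
  funext j
  ext i
  simpa [toPoint, hw0, Fin.fin_one_eq_zero j] using (congrFun hβ i).symm

lemma IsCircuit.exists_eq_monomial {α : Fin (0 + 1) → Fin n →₀ ℕ} (hf : IsCircuit f 0 α β)
    (hnonneg : IsNonneg f) : ∃ a, 0 < a ∧ f = monomial β a := by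
  obtain ⟨c, b, -, hform⟩ := hf.form
  have hmon : f = monomial β (c 0 + b) := by simp [hform, hf.eq_const_of_zero, map_add]
  have hne : c 0 + b ≠ 0 := fun h0 => by
    have hnewton := hf.newton
    rw [hmon, h0] at hnewton
    simp [newtonPolytope, Set.range_unique] at hnewton
  have hone := hnonneg 1
  rw [hmon, eval_monomial_eq_mul_mon] at hone
  exact ⟨c 0 + b, lt_of_le_of_ne (by simpa [mon] using hone) hne.symm, hmon⟩

/-- A monomial square is an interior point of the cone. -/
lemma IsBoundaryCircuit.r_pos (hf : IsBoundaryCircuit d f r α β) : 0 < r := by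
  by_contra! hr
  obtain rfl : r = 0 := by lia
  obtain ⟨a, ha, rfl⟩ := hf.circuit.exists_eq_monomial hf.nonneg
  obtain rfl := hf.circuit.eq_const_of_zero
  have hdeg : β.degree = 2 * d := hf.degree ▸ (totalDegree_monomial β ha.ne').symm
  have hpos : ∀ᶠ v in nhds fun a' : circuitExps (fun _ : Fin (0 + 1) => β) β =>
      coeff (a' : Fin n →₀ ℕ) (monomial β a), 0 < v (innerExp _ β) :=
    (continuous_apply _).continuousAt.eventually_const_lt (by simpa [innerExp] using ha)
  refine hf.not_eventually_mem_sonc (hpos.mono fun v hv => ?_)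
  have hofCoeffs : ofCoeffs _ v = monomial β (v (innerExp _ β)) := by
    obtain ⟨e, rfl⟩ := exists_extension _ v
    simp [ofCoeffs_eq_sum, innerExp]
  rw [hofCoeffs]
  exact monomial_mem_sonc (hf.circuit.even 0) hdeg.le hv

theorem IsBoundaryCircuit.exists_eq_circuitPoly (hf : IsBoundaryCircuit d f r α β) :
    ∃ (w c : Fin (r + 1) → ℝ) (b : ℝ), IsInnerPoint α β w ∧ (∀ j, 0 < c j) ∧
      f = circuitPoly α β c b ∧ (∀ s, 0 ≤ circuitNumber w c + b * (signMon β s : ℤ)) ∧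
      ∃ s, circuitNumber w c + b * (signMon β s : ℤ) = 0 := by
  obtain ⟨w, c, b, h, hc, rfl⟩ := hf.circuit.exists_isInnerPoint hf.r_pos
  exact ⟨w, c, b, h, hc, rfl, (h.isNonneg_iff hc).1 hf.nonneg, h.exists_add_mul_eq_zero hc hf⟩

end SoncBoundary

section AffineZeros

variable {n r d : ℕ}

/-! ### Affine zeros -/

/-- Some exponent lies on the `i`-th coordinate axis; the origin counts as a point of the axis.
Configurations of exponents are plain functions here, so that concrete ones can be decided. -/
def MeetsAxis (γ : Fin (r + 1) → Fin n → ℕ) (i : Fin n) : Prop :=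
  ∃ j, ∀ k, k ≠ i → γ j k = 0

instance (γ : Fin (r + 1) → Fin n → ℕ) (i : Fin n) : Decidable (MeetsAxis γ i) :=
  inferInstanceAs (Decidable (∃ j, ∀ k, k ≠ i → γ j k = 0))

/-- The zeros off the coordinate hyperplanes. -/
def torusZeros (f : MvPolynomial (Fin n) ℝ) : Set (Fin n → ℝ) :=
  {x | (∀ i, x i ≠ 0) ∧ eval x f = 0}

variable {α : Fin (r + 1) → Fin n →₀ ℕ} {β : Fin n →₀ ℕ} {w c : Fin (r + 1) → ℝ} {b : ℝ}
  {f : MvPolynomial (Fin n) ℝ}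

lemma IsBalanced.log_add_sum (hw : ∀ j, 0 < w j) (hc : ∀ j, 0 < c j) {y : Fin n → ℝ}
    (hy : ∀ i, 0 < y i) (hbal : IsBalanced α w c y) (j k : Fin (r + 1)) :
    Real.log (c j / w j) + ∑ i, (α j i : ℝ) * Real.log (y i) =
      Real.log (c k / w k) + ∑ i, (α k i : ℝ) * Real.log (y i) := by
  have hlog : ∀ j, Real.log (c j / w j * mon (α j) y) =
      Real.log (c j / w j) + ∑ i, (α j i : ℝ) * Real.log (y i) := fun j => by
    rw [Real.log_mul (div_pos (hc j) (hw j)).ne' (mon_pos _ hy).ne', mon,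
      Real.log_prod fun i _ => (pow_pos (hy i) _).ne']
    simp
  rw [← hlog, ← hlog, hbal j k]

lemma IsBalanced.mul_exp {y l : Fin n → ℝ} {s : ℝ} (hbal : IsBalanced α w c y)
    (hl : ∀ j, ∑ i, (α j i : ℝ) * l i = s) (t : ℝ) :
    IsBalanced α w c (y * fun i => Real.exp (t * l i)) := fun j k => by
  have hexp : ∀ j, mon (α j) (fun i => Real.exp (t * l i)) = Real.exp (t * s) := fun j => by
    rw [mon_exp, ← hl j, Finset.mul_sum]
    simp only [mul_left_comm]
  simp only [mon_mul, hexp, ← mul_assoc, hbal j k]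

namespace IsInnerPoint

lemma beta_ne_zero (h : IsInnerPoint α β w) {i : Fin n} {j : Fin (r + 1)} (hj : α j i ≠ 0) :
    β i ≠ 0 :=
  fun hβ => hj (h.alpha_eq_zero_of_beta_eq_zero hβ j)

lemma eq_of_isBalanced {α : Fin (n + 1) → Fin n →₀ ℕ} {w c : Fin (n + 1) → ℝ}
    (h : IsInnerPoint α β w) (hc : ∀ j, 0 < c j) {y p : Fin n → ℝ} (hy : ∀ i, 0 < y i)
    (hp : ∀ i, 0 < p i) (hby : IsBalanced α w c y) (hbp : IsBalanced α w c p) : y = p := by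
  have hlog : (fun i => Real.log (y i) - Real.log (p i)) = 0 :=
    eq_zero_of_forall_sum_mul_eq h.simplex fun j => by
      have hdiff := congrArg₂ (· - ·) (hby.log_add_sum h.pos hc hy j 0)
        (hbp.log_add_sum h.pos hc hp j 0)
      simp only [add_sub_add_left_eq_sub, ← Finset.sum_sub_distrib, ← mul_sub] at hdiff
      exact hdiff
  exact funext fun i => Real.log_injOn_pos (hy i) (hp i) (sub_eq_zero.1 (congrFun hlog i))

lemma infinite_isBalanced (h : IsInnerPoint α β w) (hc : ∀ j, 0 < c j) (hr : r < n) :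
    {y | (∀ i, 0 < y i) ∧ IsBalanced α w c y}.Infinite := by
  obtain ⟨p, hp, hbal⟩ := h.exists_isBalanced hc
  obtain ⟨l, s, hl0, hl⟩ := exists_ne_zero_forall_sum_mul_eq hr α
  obtain ⟨i, hi⟩ := Function.ne_iff.1 hl0
  refine Set.infinite_of_injective_forall_mem (f := fun t : ℝ => p * fun i => Real.exp (t * l i))
    (fun t t' htt' => ?_) fun t => ⟨fun i => mul_pos (hp i) (Real.exp_pos _), hbal.mul_exp hl t⟩
  have hti := congrFun htt' i
  simp only [Pi.mul_apply] at hti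
  exact mul_right_cancel₀ hi (Real.exp_injective (mul_left_cancel₀ (hp i).ne' hti))

lemma eval_signed_eq_zero_iff (h : IsInnerPoint α β w) (hc : ∀ j, 0 < c j)
    (hnonneg : ∀ s, 0 ≤ circuitNumber w c + b * (signMon β s : ℤ)) (s : Fin n → ℤˣ)
    {y : Fin n → ℝ} (hy : ∀ i, 0 < y i) :
    eval (signed s y) (circuitPoly α β c b) = 0 ↔
      IsBalanced α w c y ∧ circuitNumber w c + b * (signMon β s : ℤ) = 0 := by
  have hy' : ∀ i, 0 ≤ y i := fun i => (hy i).le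
  have hmon := mon_pos β hy
  rw [h.eval_signed, add_eq_zero_iff_of_nonneg
    (sub_nonneg.2 (h.circuitNumber_mul_mon_le hc hy')) (mul_nonneg (hnonneg s) hmon.le),
    sub_eq_zero, eq_comm, h.circuitNumber_mul_mon_eq_iff hc hy', mul_eq_zero_iff_right hmon.ne']

lemma signs_eq (h : IsInnerPoint α β w) (hc : ∀ j, 0 < c j) {s : Fin n → ℤˣ}
    (hs : circuitNumber w c + b * (signMon β s : ℤ) = 0) (t : Fin n → ℤˣ) :
    circuitNumber w c + b * (signMon β t : ℤ) = 0 ↔ signMon β t = signMon β s := by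
  have hb : b ≠ 0 := by
    rintro rfl
    exact (circuitNumber_pos h.pos hc).ne' (by simpa using hs)
  rw [← hs, add_right_inj, mul_right_inj' hb, Int.cast_inj, Units.ext_iff]

lemma encard_torusZeros {α : Fin (n + 1) → Fin n →₀ ℕ} {w c : Fin (n + 1) → ℝ}
    (h : IsInnerPoint α β w) (hc : ∀ j, 0 < c j)
    (hnonneg : ∀ s, 0 ≤ circuitNumber w c + b * (signMon β s : ℤ)) {s : Fin n → ℤˣ}
    (hs : circuitNumber w c + b * (signMon β s : ℤ) = 0) :
    (torusZeros (circuitPoly α β c b)).encard = orthantCount β := by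
  obtain ⟨p, hp, hbal⟩ := h.exists_isBalanced hc
  have himage : torusZeros (circuitPoly α β c b) =
      (signed · p) '' {t | signMon β t = signMon β s} := by
    ext x
    constructor
    · rintro ⟨hx, hzero⟩
      obtain ⟨t, ht⟩ := exists_signed_abs x
      have habs : ∀ i, 0 < |x| i := fun i => abs_pos.2 (hx i)
      rw [← ht, h.eval_signed_eq_zero_iff hc hnonneg t habs, h.signs_eq hc hs] at hzero
      rw [h.eq_of_isBalanced hc habs hp hzero.1 hbal] at ht
      exact ⟨t, hzero.2, ht⟩
    · rintro ⟨t, ht, rfl⟩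
      exact ⟨fun i => signed_eq_zero_iff.not.2 (hp i).ne',
        (h.eval_signed_eq_zero_iff hc hnonneg t hp).2 ⟨hbal, (h.signs_eq hc hs t).2 ht⟩⟩
  rw [himage, (signed_left_injective hp).encard_image, encard_signMon_eq]

lemma infinite_affineZeros_of_lt (h : IsInnerPoint α β w) (hc : ∀ j, 0 < c j)
    (hnonneg : ∀ s, 0 ≤ circuitNumber w c + b * (signMon β s : ℤ)) {s : Fin n → ℤˣ}
    (hs : circuitNumber w c + b * (signMon β s : ℤ) = 0) (hr : r < n) :
    (affineZeros (circuitPoly α β c b)).Infinite := by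
  refine ((h.infinite_isBalanced hc hr).image (f := signed s) ?_).mono ?_
  · intro y _ y' _ hyy'
    exact funext fun i => by simpa [signed] using congrFun hyy' i
  · rintro _ ⟨y, ⟨hy, hbal⟩, rfl⟩
    exact (h.eval_signed_eq_zero_iff hc hnonneg s hy).2 ⟨hbal, hs⟩

lemma exists_ne_zero {α : Fin (n + 1) → Fin n →₀ ℕ} {w : Fin (n + 1) → ℝ}
    (h : IsInnerPoint α β w) (i : Fin n) : ∃ j, α j i ≠ 0 := by
  by_contra! hzero
  have hsingle : (Pi.single i 1 : Fin n → ℝ) = 0 :=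
    eq_zero_of_forall_sum_mul_eq h.simplex (h := 0) fun j => by simp [Pi.single_apply, hzero j]
  simpa using congrFun hsingle i

lemma eval_eq_zero_iff_of_mon_beta_eq_zero (h : IsInnerPoint α β w) (hc : ∀ j, 0 < c j)
    {x : Fin n → ℝ} (hx : mon β x = 0) :
    eval x (circuitPoly α β c b) = 0 ↔ ∀ j, mon (α j) x = 0 := by
  rw [eval_circuitPoly, hx, mul_zero, add_zero, Finset.sum_eq_zero_iff_of_nonneg
    fun j _ => mul_nonneg (hc j).le (mon_nonneg_of_isEvenExp (h.even j) x)]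
  simp [(hc _).ne']

lemma hasConstantTerm_iff (h : IsInnerPoint α β w) (hc : ∀ j, 0 < c j) :
    HasConstantTerm (circuitPoly α β c b) ↔ ∃ j, α j = 0 := by
  constructor
  · intro hconst
    rcases eq_or_exists_eq_of_mem_support (mem_support_iff.2 hconst) with hβ | ⟨j, hj⟩
    · refine ⟨0, Finsupp.ext fun i => h.alpha_eq_zero_of_beta_eq_zero ?_ 0⟩
      simp [← hβ]
    · exact ⟨j, hj.symm⟩
  · rintro ⟨j, hj⟩
    rw [HasConstantTerm, ← hj, h.coeff_alpha]
    exact (hc j).ne'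

lemma isFullDim_iff (h : IsInnerPoint α β w) (hc : ∀ j, 0 < c j) :
    IsFullDim (circuitPoly α β c b) ↔ r = n := by
  rw [IsFullDim, h.newtonPolytope_eq hc, affineSpan_convexHull,
    h.simplex.affineSpan_eq_top_iff_card_eq_finrank_add_one]
  simp

lemma affineZeros_eq_torusZeros {α : Fin (n + 1) → Fin n →₀ ℕ} {w c : Fin (n + 1) → ℝ}
    (h : IsInnerPoint α β w) (hc : ∀ j, 0 < c j) {k : Fin (n + 1)} (hk : α k = 0) :
    affineZeros (circuitPoly α β c b) = torusZeros (circuitPoly α β c b) := by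
  refine Set.Subset.antisymm (fun x hx => ⟨fun i hi => ?_, hx⟩) fun x hx => hx.2
  obtain ⟨j, hj⟩ := h.exists_ne_zero i
  have hβ : mon β x = 0 := mon_eq_zero_iff.2 ⟨i, hi, h.beta_ne_zero hj⟩
  have hmon := (h.eval_eq_zero_iff_of_mon_beta_eq_zero hc hβ).1 hx k
  simp [hk, mon] at hmon

lemma affineZeros_eq_insert_torusZeros {α : Fin (n + 1) → Fin n →₀ ℕ} {w c : Fin (n + 1) → ℝ}
    (h : IsInnerPoint α β w) (hc : ∀ j, 0 < c j) (h0 : ∀ j, α j ≠ 0)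
    (haxis : ∀ i, MeetsAxis (fun j => α j) i) :
    affineZeros (circuitPoly α β c b) = insert 0 (torusZeros (circuitPoly α β c b)) := by
  ext x
  constructor
  · intro hx
    by_cases htorus : ∀ i, x i ≠ 0
    · exact .inr ⟨htorus, hx⟩
    push Not at htorus
    obtain ⟨i, hi⟩ := htorus
    obtain ⟨j, hj⟩ := h.exists_ne_zero i
    have hβ : mon β x = 0 := mon_eq_zero_iff.2 ⟨i, hi, h.beta_ne_zero hj⟩
    refine .inl (funext fun k => ?_)
    obtain ⟨j, hj⟩ := haxis k
    obtain ⟨l, hl, hjl⟩ :=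
      mon_eq_zero_iff.1 ((h.eval_eq_zero_iff_of_mon_beta_eq_zero hc hβ).1 hx j)
    obtain rfl : l = k := by
      by_contra hlk
      exact hjl (hj l hlk)
    exact hl
  · rintro (rfl | hx)
    · have hzero : ∀ a : Fin n →₀ ℕ, a ≠ 0 → mon a 0 = 0 := fun a ha => by
        obtain ⟨i, hi⟩ := DFunLike.ne_iff.1 ha
        exact mon_eq_zero_iff.2 ⟨i, rfl, hi⟩
      obtain ⟨i, hi⟩ := DFunLike.ne_iff.1 (h0 0)
      have hβ : β ≠ 0 := DFunLike.ne_iff.2 ⟨i, h.beta_ne_zero hi⟩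
      exact (h.eval_eq_zero_iff_of_mon_beta_eq_zero hc (hzero β hβ)).2 fun j => hzero _ (h0 j)
    · exact hx.2

lemma infinite_affineZeros_of_not_meetsAxis (h : IsInnerPoint α β w) (hc : ∀ j, 0 < c j)
    {i : Fin n} (haxis : ¬ MeetsAxis (fun j => α j) i) :
    (affineZeros (circuitPoly α β c b)).Infinite := by
  have hoff : ∀ j, ∃ k, k ≠ i ∧ α j k ≠ 0 := by simpa [MeetsAxis] using haxis
  have hinj : Function.Injective fun t : ℝ => (Pi.single i t : Fin n → ℝ) :=
    Pi.single_injective (M := fun _ : Fin n => ℝ) i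
  have hzero : ∀ (t : ℝ) (a : Fin n →₀ ℕ), (∃ k, k ≠ i ∧ a k ≠ 0) → mon a (Pi.single i t) = 0 :=
    fun t a ⟨k, hki, hk⟩ => mon_eq_zero_iff.2 ⟨k, by simp [hki], hk⟩
  obtain ⟨k, hki, hk⟩ := hoff 0
  exact Set.infinite_of_injective_forall_mem hinj fun t =>
    (h.eval_eq_zero_iff_of_mon_beta_eq_zero hc (hzero t β ⟨k, hki, h.beta_ne_zero hk⟩)).2
      fun j => hzero t (α j) (hoff j)

end IsInnerPoint

namespace IsBoundaryCircuit

lemma r_le (hf : IsBoundaryCircuit d f r α β) : r ≤ n := hf.circuit.r_le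

lemma hasConstantTerm_iff (hf : IsBoundaryCircuit d f r α β) :
    HasConstantTerm f ↔ ∃ j, α j = 0 := by
  obtain ⟨w, c, b, h, hc, rfl, -⟩ := hf.exists_eq_circuitPoly
  exact h.hasConstantTerm_iff hc

lemma isFullDim_iff (hf : IsBoundaryCircuit d f r α β) : IsFullDim f ↔ r = n := by
  obtain ⟨w, c, b, h, hc, rfl, -⟩ := hf.exists_eq_circuitPoly
  exact h.isFullDim_iff hc

lemma infinite_affineZeros_of_lt (hf : IsBoundaryCircuit d f r α β) (hr : r < n) :
    (affineZeros f).Infinite := by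
  obtain ⟨w, c, b, h, hc, rfl, hnonneg, s, hs⟩ := hf.exists_eq_circuitPoly
  exact h.infinite_affineZeros_of_lt hc hnonneg hs hr

lemma infinite_affineZeros_of_not_meetsAxis (hf : IsBoundaryCircuit d f r α β)
    {i : Fin n} (haxis : ¬ MeetsAxis (fun j => α j) i) :
    (affineZeros f).Infinite := by
  obtain ⟨w, c, b, h, hc, rfl, -⟩ := hf.exists_eq_circuitPoly
  exact h.infinite_affineZeros_of_not_meetsAxis hc haxis

variable {α : Fin (n + 1) → Fin n →₀ ℕ}

lemma encard_affineZeros_of_eq_zero (hf : IsBoundaryCircuit d f n α β) {k : Fin (n + 1)}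
    (hk : α k = 0) : (affineZeros f).encard = orthantCount β := by
  obtain ⟨w, c, b, h, hc, rfl, hnonneg, s, hs⟩ := hf.exists_eq_circuitPoly
  rw [h.affineZeros_eq_torusZeros hc hk, h.encard_torusZeros hc hnonneg hs]

lemma encard_affineZeros_of_ne_zero (hf : IsBoundaryCircuit d f n α β)
    (h0 : ∀ j, α j ≠ 0) (haxis : ∀ i, MeetsAxis (fun j => α j) i) :
    (affineZeros f).encard = orthantCount β + 1 := by
  obtain ⟨w, c, b, h, hc, rfl, hnonneg, s, hs⟩ := hf.exists_eq_circuitPoly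
  have hnot : (0 : Fin n → ℝ) ∉ torusZeros (circuitPoly α β c b) := fun hmem =>
    hmem.1 ⟨0, h.r_pos⟩ rfl
  rw [h.affineZeros_eq_insert_torusZeros hc h0 haxis, Set.encard_insert_of_notMem hnot,
    h.encard_torusZeros hc hnonneg hs]

end IsBoundaryCircuit

end AffineZeros

section ProjectiveZeros

variable {n d : ℕ} {f : MvPolynomial (Fin n) ℝ}

/-! ### Projective zeros -/

lemma eval_cons_homogenization (d : ℕ) (f : MvPolynomial (Fin n) ℝ) (t : ℝ) (x : Fin n → ℝ) :
    eval (Fin.cons t x) (homogenization d f) =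
      ∑ a ∈ f.support, coeff a f * (t ^ (2 * d - a.degree) * mon a x) := by
  simp [homogenization, eval_monomial_eq_mul_mon, mon, Fin.prod_univ_succ]

lemma eval_cons_one_homogenization (d : ℕ) (f : MvPolynomial (Fin n) ℝ) (x : Fin n → ℝ) :
    eval (Fin.cons 1 x) (homogenization d f) = eval x f := by
  rw [eval_cons_homogenization, eval_eq']
  simp [mon]

lemma eval_homogenization_smul (hf : f.totalDegree ≤ 2 * d) (s : ℝ) (v : Fin (n + 1) → ℝ) :
    eval (s • v) (homogenization d f) = s ^ (2 * d) * eval v (homogenization d f) := by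
  cases v using Fin.consCases with | cons t x
  have hcons : s • (Fin.cons t x : Fin (n + 1) → ℝ) = Fin.cons (s * t) (s • x) := by
    funext i
    cases i using Fin.cases <;> simp
  rw [hcons, eval_cons_homogenization, eval_cons_homogenization, Finset.mul_sum]
  refine Finset.sum_congr rfl fun a ha => ?_
  have hle : a.degree ≤ 2 * d := (le_totalDegree ha).trans hf
  have hpow : s ^ (2 * d) = s ^ (2 * d - a.degree) * s ^ a.degree := by
    rw [← pow_add, Nat.sub_add_cancel hle]
  rw [mon_smul, mul_pow, hpow]
  ring

lemma mk_mem_projZeros_iff (hf : f.totalDegree ≤ 2 * d) {v : Fin (n + 1) → ℝ} (hv : v ≠ 0) :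
    Projectivization.mk ℝ v hv ∈ projZeros (homogenization d f) ↔
      eval v (homogenization d f) = 0 := by
  obtain ⟨a, ha⟩ := Projectivization.exists_smul_eq_mk_rep ℝ v hv
  rw [projZeros, Set.mem_ofPred_eq, ← ha, Units.smul_def, eval_homogenization_smul hf,
    mul_eq_zero_iff_left (pow_ne_zero _ a.ne_zero)]

lemma mk_mem_zerosAtInfinity_iff (hf : f.totalDegree ≤ 2 * d) {v : Fin (n + 1) → ℝ}
    (hv : v ≠ 0) :
    Projectivization.mk ℝ v hv ∈ zerosAtInfinity (homogenization d f) ↔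
      eval v (homogenization d f) = 0 ∧ v 0 = 0 := by
  obtain ⟨a, ha⟩ := Projectivization.exists_smul_eq_mk_rep ℝ v hv
  rw [zerosAtInfinity, Set.mem_ofPred_eq, mk_mem_projZeros_iff hf, ← ha]
  simp [Units.smul_def]

lemma cons_one_ne_zero (x : Fin n → ℝ) : (Fin.cons 1 x : Fin (n + 1) → ℝ) ≠ 0 :=
  fun h => one_ne_zero (congrFun h 0)

/-- The embedding of affine space into projective space. -/
def affineChart (x : Fin n → ℝ) : Projectivization ℝ (Fin (n + 1) → ℝ) :=
  .mk ℝ (Fin.cons 1 x) (cons_one_ne_zero x)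

lemma affineChart_injective : Function.Injective (affineChart (n := n)) := by
  intro x y h
  obtain ⟨a, ha⟩ := (Projectivization.mk_eq_mk_iff' ℝ _ _ _ _).1 h
  have ha1 : a = 1 := by simpa using congrFun ha 0
  exact funext fun i => by simpa [ha1] using (congrFun ha i.succ).symm

lemma affineChart_mem_projZeros_iff (hf : f.totalDegree ≤ 2 * d) {x : Fin n → ℝ} :
    affineChart x ∈ projZeros (homogenization d f) ↔ x ∈ affineZeros f := by
  rw [affineChart, mk_mem_projZeros_iff hf, eval_cons_one_homogenization, affineZeros,
    Set.mem_ofPred_eq]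

lemma affineChart_notMem_zerosAtInfinity (hf : f.totalDegree ≤ 2 * d) (x : Fin n → ℝ) :
    affineChart x ∉ zerosAtInfinity (homogenization d f) := by
  simp [affineChart, mk_mem_zerosAtInfinity_iff hf]

lemma exists_affineChart_eq {v : Fin (n + 1) → ℝ} (hv : v ≠ 0) (h0 : v 0 ≠ 0) :
    ∃ x, affineChart x = Projectivization.mk ℝ v hv := by
  refine ⟨(v 0)⁻¹ • Fin.tail v, (Projectivization.mk_eq_mk_iff' ℝ _ _ _ _).2 ⟨(v 0)⁻¹, ?_⟩⟩
  funext i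
  cases i using Fin.cases <;> simp [Fin.tail, h0]

lemma projZeros_eq_union (hf : f.totalDegree ≤ 2 * d) :
    projZeros (homogenization d f) =
      affineChart '' affineZeros f ∪ zerosAtInfinity (homogenization d f) := by
  ext P
  constructor
  · induction P using Projectivization.ind with
    | h v hv =>
    intro hP
    by_cases h0 : v 0 = 0
    · exact .inr ((mk_mem_zerosAtInfinity_iff hf hv).2 ⟨(mk_mem_projZeros_iff hf hv).1 hP, h0⟩)
    · obtain ⟨x, hx⟩ := exists_affineChart_eq hv h0
      rw [← hx] at hP ⊢
      exact .inl ⟨x, (affineChart_mem_projZeros_iff hf).1 hP, rfl⟩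
  · rintro (⟨x, hx, rfl⟩ | hP)
    exacts [(affineChart_mem_projZeros_iff hf).2 hx, hP.1]

theorem encard_projZeros (hf : f.totalDegree ≤ 2 * d) :
    (projZeros (homogenization d f)).encard =
      (affineZeros f).encard + (zerosAtInfinity (homogenization d f)).encard := by
  rw [projZeros_eq_union hf, Set.encard_union_eq, affineChart_injective.encard_image]
  rw [Set.disjoint_left]
  rintro _ ⟨x, -, rfl⟩
  exact affineChart_notMem_zerosAtInfinity hf x

/-! ### Zeros at infinity -/

lemma cons_zero_ne_zero {v : Fin n → ℝ} (hv : v ≠ 0) :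
    (Fin.cons 0 v : Fin (n + 1) → ℝ) ≠ 0 :=
  fun h => hv (funext fun i => congrFun h i.succ)

/-- The point at infinity in direction `v`. -/
def pointAtInfinity (v : Fin n → ℝ) (hv : v ≠ 0) : Projectivization ℝ (Fin (n + 1) → ℝ) :=
  .mk ℝ (Fin.cons 0 v) (cons_zero_ne_zero hv)

lemma pointAtInfinity_eq_iff {v v' : Fin n → ℝ} (hv : v ≠ 0) (hv' : v' ≠ 0) :
    pointAtInfinity v hv = pointAtInfinity v' hv' ↔ ∃ a : ℝ, a • v' = v := by
  rw [pointAtInfinity, pointAtInfinity, Projectivization.mk_eq_mk_iff']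
  simp [funext_iff, Fin.forall_fin_succ]

lemma pointAtInfinity_mem_zerosAtInfinity_iff (hf : f.totalDegree ≤ 2 * d) {v : Fin n → ℝ}
    (hv : v ≠ 0) :
    pointAtInfinity v hv ∈ zerosAtInfinity (homogenization d f) ↔
      eval (Fin.cons 0 v) (homogenization d f) = 0 := by
  simp [pointAtInfinity, mk_mem_zerosAtInfinity_iff hf]

lemma exists_pointAtInfinity_eq {F : MvPolynomial (Fin (n + 1)) ℝ}
    {P : Projectivization ℝ (Fin (n + 1) → ℝ)} (hP : P ∈ zerosAtInfinity F) :
    ∃ v hv, pointAtInfinity v hv = P := by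
  have hcons : Fin.cons 0 (Fin.tail P.rep) = P.rep := by rw [← hP.2, Fin.cons_self_tail]
  refine ⟨Fin.tail P.rep, fun h0 => P.rep_nonzero ?_, ?_⟩
  · rw [← hcons, h0]
    exact Matrix.cons_zero_zero
  · simp only [pointAtInfinity, hcons, Projectivization.mk_rep]

/-- The point at infinity of the `i`-th coordinate axis. -/
def coordinatePoint (i : Fin n) : Projectivization ℝ (Fin (n + 1) → ℝ) :=
  pointAtInfinity (Pi.single i 1) (by simp)

lemma coordinatePoint_injective : Function.Injective (coordinatePoint (n := n)) := by
  intro i k hik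
  obtain ⟨a, ha⟩ := (pointAtInfinity_eq_iff _ _).1 hik
  by_contra hne
  simpa [hne] using congrFun ha i

lemma eval_cons_zero_homogenization (hf : f.totalDegree ≤ 2 * d) (x : Fin n → ℝ) :
    eval (Fin.cons 0 x) (homogenization d f) =
      ∑ a ∈ f.support with a.degree = 2 * d, coeff a f * mon a x := by
  rw [eval_cons_homogenization, Finset.sum_filter]
  refine Finset.sum_congr rfl fun a ha => ?_
  have hle : a.degree ≤ 2 * d := (le_totalDegree ha).trans hf
  split_ifs with hdeg
  · simp [hdeg]
  · simp [zero_pow (Nat.sub_ne_zero_of_lt (hle.lt_of_ne hdeg))]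

end ProjectiveZeros

section ZerosAtInfinity

variable {n r d : ℕ}

/-- The largest coordinate sum in a configuration of exponents. -/
def topDegree (γ : Fin (r + 1) → Fin n → ℕ) : ℕ := Finset.univ.sup fun j => ∑ i, γ j i

/-- Some exponent of top degree involves no coordinates other than `i` and `k`. -/
def HasTopExp (γ : Fin (r + 1) → Fin n → ℕ) (i k : Fin n) : Prop :=
  ∃ j, ∑ l, γ j l = topDegree γ ∧ ∀ m, m ≠ i → m ≠ k → γ j m = 0

instance (γ : Fin (r + 1) → Fin n → ℕ) (i k : Fin n) : Decidable (HasTopExp γ i k) :=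
  inferInstanceAs (Decidable (∃ j, ∑ l, γ j l = topDegree γ ∧ ∀ m, m ≠ i → m ≠ k → γ j m = 0))

/-- The coordinate directions along which no exponent has top degree. -/
def bareDirections (γ : Fin (r + 1) → Fin n → ℕ) : Finset (Fin n) :=
  Finset.univ.filter fun i => ¬ HasTopExp γ i i

lemma mem_bareDirections {γ : Fin (r + 1) → Fin n → ℕ} {i : Fin n} :
    i ∈ bareDirections γ ↔ ¬ HasTopExp γ i i := by
  simp [bareDirections]

/-- The number of zeros at infinity of a boundary circuit polynomial with outer exponents `γ`. -/
def infinityCount (γ : Fin (r + 1) → Fin n → ℕ) : ℕ∞ :=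
  if ∀ i k, i ≠ k → HasTopExp γ i k then ((bareDirections γ).card : ℕ∞) else ⊤

variable {α : Fin (r + 1) → Fin n →₀ ℕ} {β : Fin n →₀ ℕ} {f : MvPolynomial (Fin n) ℝ}

namespace IsBoundaryCircuit

lemma degree_le (hf : IsBoundaryCircuit d f r α β) (j : Fin (r + 1)) :
    (α j).degree ≤ 2 * d := by
  obtain ⟨w, c, b, h, hc, rfl, -⟩ := hf.exists_eq_circuitPoly
  exact hf.degree ▸ le_totalDegree (h.alpha_mem_support hc j)

lemma topDegree_eq (hf : IsBoundaryCircuit d f r α β) : topDegree (fun j => α j) = 2 * d := by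
  simp only [topDegree, ← Finsupp.degree_eq_sum]
  refine le_antisymm (Finset.sup_le fun j _ => hf.degree_le j) ?_
  obtain ⟨w, c, b, h, -, rfl, -⟩ := hf.exists_eq_circuitPoly
  rw [← hf.degree]
  exact h.totalDegree_le (fun j => Finset.le_sup (f := fun j => (α j).degree)
    (Finset.mem_univ j)) c b

lemma exists_degree_lt_of_eq_zero (hf : IsBoundaryCircuit d f r α β) {k : Fin (r + 1)}
    (hk : α k = 0) : ∃ j, (α j).degree < 2 * d := by
  obtain ⟨w, c, b, h, -⟩ := hf.exists_eq_circuitPoly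
  by_contra! hall
  have hd : 2 * d = 0 := by simpa [hk] using hall k
  have hzero : ∀ j, α j = 0 := fun j =>
    (Finsupp.degree_eq_zero_iff _).1 (by simpa [hd] using hf.degree_le j)
  have : Nontrivial (Fin (r + 1)) := Fin.nontrivial_iff_two_le.2 (by have := h.r_pos; lia)
  obtain ⟨j, hj⟩ := exists_ne k
  exact hj (h.injective (by rw [hzero, hzero]))

lemma exists_degree_lt {α : Fin (n + 1) → Fin n →₀ ℕ} (hf : IsBoundaryCircuit d f n α β) :
    ∃ j, (α j).degree < 2 * d := by
  obtain ⟨w, c, b, h, -⟩ := hf.exists_eq_circuitPoly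
  by_contra! hall
  have hone : (1 : Fin n → ℝ) = 0 :=
    eq_zero_of_forall_sum_mul_eq h.simplex (h := 2 * d) fun j => by
      have hdeg := (hf.degree_le j).antisymm (hall j)
      simp only [Pi.one_apply, mul_one]
      rw [Finsupp.degree_eq_sum] at hdeg
      exact_mod_cast hdeg
  exact one_ne_zero (congrFun hone ⟨0, h.r_pos⟩)

lemma pointAtInfinity_mem_iff (hf : IsBoundaryCircuit d f r α β)
    (hlt : ∃ j, (α j).degree < 2 * d) {v : Fin n → ℝ} (hv : v ≠ 0) :
    pointAtInfinity v hv ∈ zerosAtInfinity (homogenization d f) ↔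
      ∀ j, ∑ i, α j i = topDegree (fun j => α j) → ∃ i, v i = 0 ∧ α j i ≠ 0 := by
  obtain ⟨k, hk⟩ := hlt
  have hdeg := hf.degree_le
  have htop := hf.topDegree_eq
  rw [pointAtInfinity_mem_zerosAtInfinity_iff hf.degree.le,
    eval_cons_zero_homogenization hf.degree.le, htop]
  obtain ⟨w, c, b, h, hc, rfl, -⟩ := hf.exists_eq_circuitPoly
  have hmem : ∀ a, a ∈ {a ∈ (circuitPoly α β c b).support | a.degree = 2 * d} ↔
      ∃ j, (α j).degree = 2 * d ∧ α j = a := by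
    intro a
    rw [Finset.mem_filter]
    constructor
    · rintro ⟨ha, hdega⟩
      rcases eq_or_exists_eq_of_mem_support ha with rfl | ⟨j, rfl⟩
      exacts [absurd hdega (h.degree_beta_lt hdeg hk).ne, ⟨j, hdega, rfl⟩]
    · rintro ⟨j, hj, rfl⟩
      exact ⟨h.alpha_mem_support hc j, hj⟩
  rw [Finset.sum_eq_zero_iff_of_nonneg]
  · simp [hmem, h.coeff_alpha, (hc _).ne', mon_eq_zero_iff, ← Finsupp.degree_eq_sum]
  · intro a ha
    obtain ⟨j, -, rfl⟩ := (hmem a).1 ha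
    rw [h.coeff_alpha]
    exact mul_nonneg (hc j).le (mon_nonneg_of_isEvenExp (h.even j) v)

lemma infinite_zerosAtInfinity (hf : IsBoundaryCircuit d f r α β)
    (hlt : ∃ j, (α j).degree < 2 * d) {i k : Fin n} (hik : i ≠ k)
    (htop : ¬ HasTopExp (fun j => α j) i k) :
    (zerosAtInfinity (homogenization d f)).Infinite := by
  let v : ℝ → Fin n → ℝ := fun t => Pi.single i 1 + Pi.single k t
  have hvi : ∀ t, v t i = 1 := fun t => by simp [v, hik]
  have hvk : ∀ t, v t k = t := fun t => by simp [v, hik.symm]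
  have hv : ∀ t, v t ≠ 0 := fun t h0 => one_ne_zero ((hvi t).symm.trans (congrFun h0 i))
  refine Set.infinite_of_injective_forall_mem (f := fun t => pointAtInfinity (v t) (hv t))
    (fun s t hst => ?_) fun t => ?_
  · obtain ⟨a, ha⟩ := (pointAtInfinity_eq_iff _ _).1 hst
    have ha1 : a = 1 := by simpa [hvi] using congrFun ha i
    simpa [ha1, hvk] using (congrFun ha k).symm
  · rw [hf.pointAtInfinity_mem_iff hlt]
    intro j hj
    by_contra! hcon
    exact htop ⟨j, hj, fun m hmi hmk => hcon m (by simp [v, hmi, hmk])⟩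

lemma zerosAtInfinity_eq_image (hf : IsBoundaryCircuit d f r α β)
    (hlt : ∃ j, (α j).degree < 2 * d)
    (htop : ∀ i k, i ≠ k → HasTopExp (fun j => α j) i k) :
    zerosAtInfinity (homogenization d f) = coordinatePoint '' bareDirections (fun j => α j) := by
  ext P
  constructor
  · intro hP
    obtain ⟨v, hv, rfl⟩ := exists_pointAtInfinity_eq hP
    rw [hf.pointAtInfinity_mem_iff hlt] at hP
    obtain ⟨i, hi⟩ := Function.ne_iff.1 hv
    have hsingle : v = v i • Pi.single i 1 := by
      funext k
      by_cases hki : k = i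
      · simp [hki]
      suffices v k = 0 by simp [hki, this]
      by_contra hk
      obtain ⟨j, hj, hsupp⟩ := htop i k (Ne.symm hki)
      obtain ⟨m, hm, hjm⟩ := hP j hj
      exact hjm (hsupp m (ne_of_apply_ne v (by rwa [hm, ne_comm]))
        (ne_of_apply_ne v (by rwa [hm, ne_comm])))
    refine ⟨i, mem_bareDirections.2 ?_, ?_⟩
    · rintro ⟨j, hj, hsupp⟩
      obtain ⟨m, hm, hjm⟩ := hP j hj
      have hmi : m ≠ i := ne_of_apply_ne v (by rwa [hm, ne_comm])
      exact hjm (hsupp m hmi hmi)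
    · exact (pointAtInfinity_eq_iff _ _).2 ⟨(v i)⁻¹, (inv_smul_eq_iff₀ hi).2 hsingle⟩
  · rintro ⟨i, hi, rfl⟩
    rw [coordinatePoint, hf.pointAtInfinity_mem_iff hlt]
    intro j hj
    by_contra! hcon
    exact mem_bareDirections.1 hi ⟨j, hj, fun m hmi _ => hcon m (by simp [hmi])⟩

theorem encard_zerosAtInfinity (hf : IsBoundaryCircuit d f r α β)
    (hlt : ∃ j, (α j).degree < 2 * d) :
    (zerosAtInfinity (homogenization d f)).encard = infinityCount (fun j => α j) := by
  rw [infinityCount]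
  split_ifs with htop
  · rw [hf.zerosAtInfinity_eq_image hlt htop, coordinatePoint_injective.encard_image,
      Set.encard_coe_eq_coe_finsetCard]
  · push Not at htop
    obtain ⟨i, k, hik, htop⟩ := htop
    exact (hf.infinite_zerosAtInfinity hlt hik htop).encard_eq

end IsBoundaryCircuit

/-! ### Bounds for the number of zeros at infinity -/

lemma card_add_choose_two_le {ι κ : Type*} [DecidableEq ι] {S : κ → Finset ι} {J : Finset κ}
    {A B : Finset ι} (hA : ∀ i ∈ A, ∃ j ∈ J, S j = {i})
    (hB : ∀ i ∈ B, ∀ k ∈ B, i ≠ k → ∃ j ∈ J, S j = {i, k}) :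
    A.card + B.card.choose 2 ≤ J.card := by
  have hdisj : Disjoint (A.image fun i => ({i} : Finset ι)) (B.powersetCard 2) := by
    rw [Finset.disjoint_left]
    intro T hT hT'
    obtain ⟨i, -, rfl⟩ := Finset.mem_image.1 hT
    simpa using (Finset.mem_powersetCard.1 hT').2
  have hsub : (A.image fun i => ({i} : Finset ι)) ∪ B.powersetCard 2 ⊆ J.image S := by
    refine Finset.union_subset ?_ fun T hT => ?_
    · simpa [Finset.subset_iff] using hA
    · obtain ⟨hTB, hT2⟩ := Finset.mem_powersetCard.1 hT
      obtain ⟨i, k, hik, rfl⟩ := Finset.card_eq_two.1 hT2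
      exact Finset.mem_image.2 (hB i (hTB (by simp)) k (hTB (by simp)) hik)
  calc A.card + B.card.choose 2
      = ((A.image fun i => ({i} : Finset ι)) ∪ B.powersetCard 2).card := by
        rw [Finset.card_union_of_disjoint hdisj, Finset.card_powersetCard,
          Finset.card_image_of_injective _ Finset.singleton_injective]
    _ ≤ J.card := (Finset.card_le_card hsub).trans Finset.card_image_le

lemma le_three_of_choose_two_le {s : ℕ} (h : s.choose 2 ≤ s) : s ≤ 3 := by
  by_contra! hs
  obtain ⟨t, rfl⟩ := Nat.exists_eq_add_of_le' hs
  have hchoose : Nat.choose 3 2 ≤ (t + 3).choose 2 := Nat.choose_le_choose 2 (by lia)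
  rw [Nat.choose_succ_succ', Nat.choose_one_right] at h
  simp only [Nat.choose_succ_self_right] at hchoose
  lia

lemma le_two_of_choose_two_le {s : ℕ} (h : s.choose 2 ≤ 1) : s ≤ 2 := by
  by_contra! hs
  have hchoose : Nat.choose 3 2 ≤ s.choose 2 := Nat.choose_le_choose 2 hs
  simp only [Nat.choose_succ_self_right] at hchoose
  lia

lemma card_add_choose_bareDirections_le {γ : Fin (r + 1) → Fin n → ℕ}
    (htop : ∀ i k, i ≠ k → HasTopExp γ i k) {A : Finset (Fin n)}
    (hA : ∀ i ∈ A, ∃ j, γ j ≠ 0 ∧ ∀ k, k ≠ i → γ j k = 0) :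
    A.card + (bareDirections γ).card.choose 2 ≤ (Finset.univ.filter fun j => γ j ≠ 0).card := by
  have hne : ∀ {i j k}, ¬ HasTopExp γ k k → ∑ l, γ j l = topDegree γ →
      (∀ m, m ≠ i → m ≠ k → γ j m = 0) → γ j i ≠ 0 := fun {i j k} hk hj hsupp hi =>
    hk ⟨j, hj, fun m hm _ => by
      by_cases hmi : m = i
      exacts [hmi ▸ hi, hsupp m hmi hm]⟩
  refine card_add_choose_two_le (S := fun j => Finset.univ.filter fun i => γ j i ≠ 0)
    (fun i hi => ?_) fun i hi k hk hik => ?_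
  · obtain ⟨j, hj, hsupp⟩ := hA i hi
    obtain ⟨m, hm⟩ := Function.ne_iff.1 hj
    have hmi : m = i := by_contra fun hmi => hm (hsupp m hmi)
    refine ⟨j, by simpa using hj, Finset.ext fun l => ?_⟩
    by_cases hl : l = i
    · simpa [hl, ← hmi] using hm
    · simp [hl, hsupp l hl]
  · obtain ⟨j, hj, hsupp⟩ := htop i k hik
    have hji := hne (mem_bareDirections.1 hk) hj hsupp
    have hjk := hne (mem_bareDirections.1 hi) hj fun m hmk hmi => hsupp m hmi hmk
    refine ⟨j, by simpa using fun h0 => hji (congrFun h0 i), Finset.ext fun l => ?_⟩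
    by_cases hli : l = i
    · simp [hli, hji]
    by_cases hlk : l = k
    · simp [hlk, hjk]
    · simp [hli, hlk, hsupp l hli hlk]

lemma infinityCount_le_three_or_eq_top {γ : Fin (r + 1) → Fin n → ℕ} (hr : r ≤ n)
    (hD : topDegree γ ≠ 0) {k : Fin (r + 1)} (hk : γ k = 0) :
    infinityCount γ ≤ 3 ∨ infinityCount γ = ⊤ := by
  rw [infinityCount]
  split_ifs with htop
  swap
  · exact .inr rfl
  have hcount := card_add_choose_bareDirections_le htop (A := (bareDirections γ)ᶜ) fun i hi => by
    obtain ⟨j, hj, hsupp⟩ : HasTopExp γ i i := by simpa [mem_bareDirections] using hi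
    refine ⟨j, fun h0 => hD ?_, fun k hk => hsupp k hk hk⟩
    simp [← hj, h0]
  have hnonzero : (Finset.univ.filter fun j => γ j ≠ 0).card ≤ r := by
    have hsub : (Finset.univ.filter fun j => γ j ≠ 0) ⊆ Finset.univ.erase k := fun j hj =>
      Finset.mem_erase.2 ⟨by rintro rfl; simp [hk] at hj, Finset.mem_univ j⟩
    simpa using Finset.card_le_card hsub
  have hcompl := Finset.card_add_card_compl (bareDirections γ)
  rw [Fintype.card_fin] at hcompl
  exact .inl (by exact_mod_cast le_three_of_choose_two_le (by lia))

lemma infinityCount_le_two_or_eq_top {γ : Fin (n + 1) → Fin n → ℕ} (h0 : ∀ j, γ j ≠ 0)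
    (haxis : ∀ i, MeetsAxis γ i) : infinityCount γ ≤ 2 ∨ infinityCount γ = ⊤ := by
  rw [infinityCount]
  split_ifs with htop
  swap
  · exact .inr rfl
  have hcount := card_add_choose_bareDirections_le htop (A := Finset.univ) fun i _ =>
    (haxis i).imp fun j hj => ⟨h0 j, hj⟩
  simp only [h0, ne_eq, not_false_eq_true, Finset.filter_true, Finset.card_univ,
    Fintype.card_fin] at hcount
  exact .inl (by exact_mod_cast le_two_of_choose_two_le (by lia))

lemma infinityCount_le_two (γ : Fin (r + 1) → Fin 2 → ℕ) : infinityCount γ ≤ 2 := by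
  obtain ⟨j, -, hj⟩ := Finset.exists_mem_eq_sup Finset.univ Finset.univ_nonempty
    fun j => ∑ i, γ j i
  have htop : ∀ i k, i ≠ k → HasTopExp γ i k := fun i k hik =>
    ⟨j, hj.symm, fun m hmi hmk => by lia⟩
  rw [infinityCount, if_pos htop]
  exact_mod_cast Finset.card_le_univ (bareDirections γ)

/-! ### Zeros of boundary circuit polynomials -/

namespace IsBoundaryCircuit

lemma topDegree_ne_zero (hf : IsBoundaryCircuit d f r α β)
    (hlt : ∃ j, (α j).degree < 2 * d) : topDegree (fun j => α j) ≠ 0 := by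
  obtain ⟨j, hj⟩ := hlt
  rw [hf.topDegree_eq]
  lia

lemma encard_affineZeros_of_hasConstantTerm (hf : IsBoundaryCircuit d f r α β)
    (hconst : HasConstantTerm f) (hdeg : ¬ IsDegenerate f) :
    (affineZeros f).encard = orthantCount β := by
  obtain ⟨k, hk⟩ := hf.hasConstantTerm_iff.1 hconst
  rcases hf.r_le.lt_or_eq with hr | rfl
  · exact absurd ⟨hf.infinite_affineZeros_of_lt hr, hf.isFullDim_iff.not.2 hr.ne⟩ hdeg
  · exact hf.encard_affineZeros_of_eq_zero hk

lemma encard_affineZeros_or_infinite (hf : IsBoundaryCircuit d f r α β)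
    (hconst : ¬ HasConstantTerm f) :
    (affineZeros f).encard = orthantCount β + 1 ∨ (affineZeros f).Infinite := by
  rcases hf.r_le.lt_or_eq with hr | rfl
  · exact .inr (hf.infinite_affineZeros_of_lt hr)
  by_cases haxis : ∀ i, MeetsAxis (fun j => α j) i
  · exact .inl (hf.encard_affineZeros_of_ne_zero
      (fun j hj => hconst (hf.hasConstantTerm_iff.2 ⟨j, hj⟩)) haxis)
  · push Not at haxis
    obtain ⟨i, hi⟩ := haxis
    exact .inr (hf.infinite_affineZeros_of_not_meetsAxis hi)

lemma encard_zerosAtInfinity_le_three_or_infinite (hf : IsBoundaryCircuit d f r α β)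
    (hconst : HasConstantTerm f) :
    (zerosAtInfinity (homogenization d f)).encard ≤ 3 ∨
      (zerosAtInfinity (homogenization d f)).Infinite := by
  obtain ⟨k, hk⟩ := hf.hasConstantTerm_iff.1 hconst
  have hlt := hf.exists_degree_lt_of_eq_zero hk
  rw [← Set.encard_eq_top_iff, hf.encard_zerosAtInfinity hlt]
  exact infinityCount_le_three_or_eq_top hf.r_le (hf.topDegree_ne_zero hlt) (k := k) (by simp [hk])

lemma encard_zerosAtInfinity_le_two_or_infinite (hf : IsBoundaryCircuit d f r α β)
    (hconst : ¬ HasConstantTerm f) :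
    (zerosAtInfinity (homogenization d f)).encard ≤ 2 ∨
      (zerosAtInfinity (homogenization d f)).Infinite ∨ (affineZeros f).Infinite := by
  rcases hf.r_le.lt_or_eq with hr | rfl
  · exact .inr (.inr (hf.infinite_affineZeros_of_lt hr))
  by_cases haxis : ∀ i, MeetsAxis (fun j => α j) i
  · rw [← or_assoc, ← Set.encard_eq_top_iff, hf.encard_zerosAtInfinity hf.exists_degree_lt]
    exact .inl (infinityCount_le_two_or_eq_top (fun j hj => hconst (hf.hasConstantTerm_iff.2
      ⟨j, DFunLike.coe_injective hj⟩)) haxis)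
  · push Not at haxis
    obtain ⟨i, hi⟩ := haxis
    exact .inr (.inr (hf.infinite_affineZeros_of_not_meetsAxis hi))

variable {f : MvPolynomial (Fin 2) ℝ} {α : Fin (r + 1) → Fin 2 →₀ ℕ} {β : Fin 2 →₀ ℕ}

lemma encard_zerosAtInfinity_le_two (hf : IsBoundaryCircuit d f r α β)
    (hfin : (affineZeros f).Finite) : (zerosAtInfinity (homogenization d f)).encard ≤ 2 := by
  rcases hf.r_le.lt_or_eq with hr | rfl
  · exact absurd hfin (hf.infinite_affineZeros_of_lt hr)
  · exact (hf.encard_zerosAtInfinity hf.exists_degree_lt).trans_le (infinityCount_le_two _)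

lemma encard_projZeros_mem (hf : IsBoundaryCircuit d f r α β) (hfin : (affineZeros f).Finite) :
    (projZeros (homogenization d f)).encard ∈
      ({(affineZeros f).encard, (affineZeros f).encard + 1, (affineZeros f).encard + 2} :
        Set ℕ∞) := by
  have hle := hf.encard_zerosAtInfinity_le_two hfin
  rw [encard_projZeros hf.degree.le]
  generalize (zerosAtInfinity (homogenization d f)).encard = e at hle
  lift e to ℕ using ne_top_of_le_ne_top (by simp) hle
  have hle : e ≤ 2 := by exact_mod_cast hle
  interval_cases e <;> simp

theorem bivariate_zeros_of_hasConstantTerm (hf : IsBoundaryCircuit d f r α β)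
    (hconst : HasConstantTerm f) (hdeg : ¬ IsDegenerate f) :
    (IsEvenExp β → (affineZeros f).encard = 4 ∧
      (projZeros (homogenization d f)).encard ∈ ({4, 5, 6} : Set ℕ∞)) ∧
    (¬ IsEvenExp β → (affineZeros f).encard = 2 ∧
      (projZeros (homogenization d f)).encard ∈ ({2, 3, 4} : Set ℕ∞)) := by
  have haffine := hf.encard_affineZeros_of_hasConstantTerm hconst hdeg
  have hproj := hf.encard_projZeros_mem (Set.finite_of_encard_eq_coe haffine)
  constructor <;> intro hβ <;> simp only [orthantCount, hβ, if_true, if_false] at haffine <;>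
    rw [haffine] at hproj <;> exact ⟨haffine, hproj⟩

theorem bivariate_zeros_of_not_hasConstantTerm (hf : IsBoundaryCircuit d f r α β)
    (hconst : ¬ HasConstantTerm f) :
    (IsEvenExp β →
      ((affineZeros f).encard = 5 ∧
        (projZeros (homogenization d f)).encard ∈ ({5, 6, 7} : Set ℕ∞)) ∨
      ((affineZeros f).encard = ⊤ ∧ (projZeros (homogenization d f)).encard = ⊤)) ∧
    (¬ IsEvenExp β →
      ((affineZeros f).encard = 3 ∧
        (projZeros (homogenization d f)).encard ∈ ({3, 4, 5} : Set ℕ∞)) ∨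
      ((affineZeros f).encard = ⊤ ∧ (projZeros (homogenization d f)).encard = ⊤)) := by
  rcases hf.encard_affineZeros_or_infinite hconst with haffine | hinf
  · have hproj := hf.encard_projZeros_mem
      (Set.finite_of_encard_eq_coe (k := orthantCount β + 1) (by simpa using haffine))
    constructor <;> intro hβ <;> simp only [orthantCount, hβ, if_true, if_false] at haffine <;>
      rw [haffine] at hproj <;> exact .inl ⟨haffine, hproj⟩
  · simp [encard_projZeros hf.degree.le, hinf.encard_eq]

end IsBoundaryCircuit

end ZerosAtInfinity

section LatticeSimplices

variable {n r d M : ℕ}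

/-! ### Examples from lattice simplices -/

/-- The dilates by `M` of the points `γ j`. -/
def dilate (M : ℕ) (γ : Fin (r + 1) → Fin n → ℕ) (j : Fin (r + 1)) : Fin n →₀ ℕ :=
  Finsupp.equivFunOnFinite.symm fun i => M * γ j i

/-- The integral combination `∑ m_j γ_j`; it is the point with barycentric coordinates
`m_j / ∑ m` in the dilate by `∑ m` of the simplex with vertices `γ`. -/
def combine (m : Fin (r + 1) → ℕ) (γ : Fin (r + 1) → Fin n → ℕ) : Fin n →₀ ℕ :=
  Finsupp.equivFunOnFinite.symm fun i => ∑ j, m j * γ j i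

@[simp]
lemma dilate_apply (M : ℕ) (γ : Fin (r + 1) → Fin n → ℕ) (j : Fin (r + 1)) (i : Fin n) :
    dilate M γ j i = M * γ j i := rfl

@[simp]
lemma combine_apply (m : Fin (r + 1) → ℕ) (γ : Fin (r + 1) → Fin n → ℕ) (i : Fin n) :
    combine m γ i = ∑ j, m j * γ j i := rfl

variable {γ : Fin (r + 1) → Fin n → ℕ}

lemma dilate_eq_zero_iff (hM : 0 < M) {j : Fin (r + 1)} : dilate M γ j = 0 ↔ γ j = 0 := by
  rw [DFunLike.ext_iff, funext_iff]
  simp [hM.ne']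

lemma meetsAxis_dilate_iff (hM : 0 < M) {i : Fin n} :
    MeetsAxis (fun j => dilate M γ j) i ↔ MeetsAxis γ i := by
  simp [MeetsAxis, hM.ne']

lemma topDegree_dilate : topDegree (fun j => dilate M γ j) = M * topDegree γ := by
  simp only [topDegree, dilate_apply, ← Finset.mul_sum]
  exact (Finset.apply_sup_eq_sup_comp (M * ·) (fun a b => mul_max_of_nonneg a b M.zero_le)
    (mul_zero M)).symm

lemma hasTopExp_dilate_iff (hM : 0 < M) {i k : Fin n} :
    HasTopExp (fun j => dilate M γ j) i k ↔ HasTopExp γ i k := by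
  simp [HasTopExp, topDegree_dilate, ← Finset.mul_sum, hM.ne']

lemma infinityCount_dilate (hM : 0 < M) :
    infinityCount (fun j => dilate M γ j) = infinityCount γ := by
  simp only [infinityCount, bareDirections, hasTopExp_dilate_iff hM]

lemma isInnerPoint_dilate (hr : 0 < r) (hγ : AffineIndependent ℝ fun j i => (γ j i : ℝ))
    {m : Fin (r + 1) → ℕ} (hm : ∀ j, 0 < m j) (heven : Even (∑ j, m j)) :
    IsInnerPoint (dilate (∑ j, m j) γ) (combine m γ) fun j => (m j : ℝ) / (∑ j, m j : ℕ) := by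
  have hpos : 0 < ∑ j, m j := Finset.sum_pos (fun j _ => hm j) Finset.univ_nonempty
  set M := ∑ j, m j with hMdef
  have hM : (M : ℝ) ≠ 0 := by exact_mod_cast hpos.ne'
  refine ⟨hr, fun j i => heven.mul_right _, ?_, fun j => ?_, ?_, fun i => ?_⟩
  · rw [affineIndependent_iff_forall_sum_mul_eq_zero] at hγ ⊢
    refine fun u hu hs => hγ u hu fun i => ?_
    simpa [toPoint, mul_left_comm _ (M : ℝ), ← Finset.mul_sum, hM] using hs i
  · exact div_pos (by exact_mod_cast hm j) (by exact_mod_cast hpos)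
  · rw [← Finset.sum_div, ← Nat.cast_sum, ← hMdef, div_self hM]
  · simp only [combine_apply, Nat.cast_sum, Nat.cast_mul, dilate_apply]
    refine Finset.sum_congr rfl fun j _ => ?_
    field_simp

theorem exists_isBoundaryCircuit_dilate (hr : 0 < r)
    (hγ : AffineIndependent ℝ fun j i => (γ j i : ℝ)) {m : Fin (r + 1) → ℕ} (hm : ∀ j, 0 < m j)
    (heven : Even (∑ j, m j)) :
    ∃ d f, IsBoundaryCircuit d f r (dilate (∑ j, m j) γ) (combine m γ) := by
  have h := isInnerPoint_dilate hr hγ hm heven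
  obtain ⟨d, hd⟩ := heven.mul_right (topDegree γ)
  rw [← two_mul, ← topDegree_dilate] at hd
  obtain ⟨k, -, hk⟩ := Finset.exists_mem_eq_sup Finset.univ Finset.univ_nonempty
    fun j => ∑ i, dilate (∑ j, m j) γ j i
  refine ⟨d, _, h.isBoundaryCircuit (c := 1) (fun _ => one_pos) (fun j => ?_) (k := k) ?_⟩
  · rw [← hd, Finsupp.degree_eq_sum]
    exact Finset.le_sup (f := fun j => ∑ i, dilate (∑ j, m j) γ j i) (Finset.mem_univ j)
  · rw [← hd, Finsupp.degree_eq_sum, ← hk, topDegree]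

variable {γ : Fin (n + 1) → Fin n → ℕ} {Q : ℕ → MvPolynomial (Fin n) ℝ → (Fin n →₀ ℕ) → Prop}

lemma occurs_of_affineIndependent (hn : 0 < n)
    (hγ : AffineIndependent ℝ fun j i => (γ j i : ℝ)) {m : Fin (n + 1) → ℕ} (hm : ∀ j, 0 < m j)
    (heven : Even (∑ j, m j))
    (hQ : ∀ d f, IsBoundaryCircuit d f n (dilate (∑ j, m j) γ) (combine m γ) →
      Q d f (combine m γ)) :
    Occurs n Q := by
  obtain ⟨d, f, hf⟩ := exists_isBoundaryCircuit_dilate hn hγ hm heven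
  exact ⟨d, f, n, _, _, hf, hf.isFullDim_iff.2 rfl, hQ d f hf⟩

lemma occurs_isEvenExp (hn : 0 < n) (hγ : AffineIndependent ℝ fun j i => (γ j i : ℝ))
    (hQ : ∀ M d f β, 0 < M → IsBoundaryCircuit d f n (dilate M γ) β → Q d f β) :
    Occurs n fun d f β => IsEvenExp β ∧ Q d f β :=
  occurs_of_affineIndependent hn hγ (m := fun _ => 2) (fun _ => two_pos) (by simp)
    fun d f hf => ⟨fun i => by simp [← Finset.mul_sum], hQ _ d f _ (by simp) hf⟩

lemma occurs_not_isEvenExp {γ : Fin (2 + 1) → Fin 2 → ℕ}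
    {Q : ℕ → MvPolynomial (Fin 2) ℝ → (Fin 2 →₀ ℕ) → Prop}
    (hγ : AffineIndependent ℝ fun j i => (γ j i : ℝ)) (hodd : ∃ i, Odd (γ 1 i + γ 2 i))
    (hQ : ∀ M d f β, 0 < M → IsBoundaryCircuit d f 2 (dilate M γ) β → Q d f β) :
    Occurs 2 fun d f β => ¬ IsEvenExp β ∧ Q d f β := by
  obtain ⟨i, hi⟩ := hodd
  refine occurs_of_affineIndependent two_pos hγ (m := ![2, 1, 1]) (by decide) (by decide)
    fun d f hf => ⟨fun h => Nat.not_even_iff_odd.2 hi ?_, hQ _ d f _ (by decide) hf⟩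
  simpa [Fin.sum_univ_three, add_assoc, Nat.even_add, parity_simps] using h i

/-- A full-dimensional lattice simplex whose dilates are the outer exponents of boundary circuit
polynomials with finitely many real zeros and with `k` zeros at infinity; `C` says whether these
polynomials have a constant term. -/
structure IsModel (γ : Fin (n + 1) → Fin n → ℕ) (C : Prop) (k : ℕ∞) : Prop where
  affineIndependent : AffineIndependent ℝ fun j i => (γ j i : ℝ)
  exists_eq_zero_iff : (∃ j, γ j = 0) ↔ C
  meetsAxis : ∀ i, MeetsAxis γ i
  infinityCount_eq : infinityCount γ = k

namespace IsModel

variable {C : Prop} {k : ℕ∞} {f : MvPolynomial (Fin n) ℝ} {β : Fin n →₀ ℕ}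

lemma hasConstantTerm_iff (h : IsModel γ C k) (hM : 0 < M)
    (hf : IsBoundaryCircuit d f n (dilate M γ) β) : HasConstantTerm f ↔ C := by
  rw [hf.hasConstantTerm_iff, ← h.exists_eq_zero_iff]
  exact exists_congr fun j => dilate_eq_zero_iff hM

lemma encard_zerosAtInfinity (h : IsModel γ C k) (hM : 0 < M)
    (hf : IsBoundaryCircuit d f n (dilate M γ) β) :
    (zerosAtInfinity (homogenization d f)).encard = k := by
  rw [hf.encard_zerosAtInfinity hf.exists_degree_lt, infinityCount_dilate hM, h.infinityCount_eq]

lemma encard_affineZeros_of_true (h : IsModel γ True k) (hM : 0 < M)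
    (hf : IsBoundaryCircuit d f n (dilate M γ) β) :
    (affineZeros f).encard = orthantCount β := by
  obtain ⟨j, hj⟩ := h.exists_eq_zero_iff.2 trivial
  exact hf.encard_affineZeros_of_eq_zero ((dilate_eq_zero_iff hM).2 hj)

lemma encard_affineZeros_of_false (h : IsModel γ False k) (hM : 0 < M)
    (hf : IsBoundaryCircuit d f n (dilate M γ) β) :
    (affineZeros f).encard = orthantCount β + 1 :=
  hf.encard_affineZeros_of_ne_zero
    (fun j hj => h.exists_eq_zero_iff.1 ⟨j, (dilate_eq_zero_iff hM).1 hj⟩)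
    fun i => (meetsAxis_dilate_iff hM).2 (h.meetsAxis i)

lemma finite_affineZeros (h : IsModel γ C k) (hM : 0 < M)
    (hf : IsBoundaryCircuit d f n (dilate M γ) β) : (affineZeros f).Finite := by
  by_cases hC : C <;> simp only [hC] at h
  · exact Set.finite_of_encard_eq_coe (h.encard_affineZeros_of_true hM hf)
  · exact Set.finite_of_encard_eq_coe (k := orthantCount β + 1)
      (by simpa using h.encard_affineZeros_of_false hM hf)

end IsModel

/-! ### Pyramids -/

/-- The pyramid over `γ` whose apex is the multiple of a new unit vector of degree
`topDegree γ`, so that it has the same top degree as `γ`. -/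
def pyramid (γ : Fin (r + 1) → Fin n → ℕ) : Fin (r + 1 + 1) → Fin (n + 1) → ℕ :=
  Fin.cons (Fin.cons (topDegree γ) 0) fun j => Fin.cons 0 (γ j)

section Pyramid

variable {γ : Fin (r + 1) → Fin n → ℕ}

lemma topDegree_pos (hr : 0 < r) (hγ : AffineIndependent ℝ fun j i => (γ j i : ℝ)) :
    0 < topDegree γ := by
  have : Nontrivial (Fin (r + 1)) := Fin.nontrivial_iff_two_le.2 (by lia)
  obtain ⟨j, hj⟩ : ∃ j, γ j ≠ 0 := by
    by_contra! h0
    obtain ⟨j, hj⟩ := exists_ne (0 : Fin (r + 1))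
    exact hj (hγ.injective (by simp [h0]))
  obtain ⟨i, hi⟩ := Function.ne_iff.1 hj
  exact Finset.lt_sup_iff.2 ⟨j, Finset.mem_univ j,
    (Nat.pos_of_ne_zero hi).trans_le (Finset.single_le_sum_of_canonicallyOrdered
      (f := γ j) (Finset.mem_univ i))⟩

lemma topDegree_pyramid : topDegree (pyramid γ) = topDegree γ := by
  have hsup : (Finset.univ.sup fun j : Fin (r + 1) => ∑ i, γ j i) = topDegree γ := rfl
  rw [topDegree, Fin.univ_succ]
  simp [pyramid, Finset.sup_map, Fin.sum_univ_succ, Function.comp_def, hsup]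

lemma affineIndependent_pyramid (hD : 0 < topDegree γ)
    (hγ : AffineIndependent ℝ fun j i => (γ j i : ℝ)) :
    AffineIndependent ℝ fun j i => (pyramid γ j i : ℝ) := by
  rw [affineIndependent_iff_forall_sum_mul_eq_zero] at hγ ⊢
  intro u hu hs
  have hu0 : u 0 = 0 := by simpa [pyramid, Fin.sum_univ_succ, hD.ne'] using hs 0
  have htail : Fin.tail u = 0 := hγ _ (by simpa [Fin.sum_univ_succ, hu0, Fin.tail] using hu)
    fun i => by simpa [pyramid, Fin.sum_univ_succ, hu0, Fin.tail] using hs i.succ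
  exact funext (Fin.cases hu0 (congrFun htail))

lemma exists_pyramid_eq_zero_iff (hD : 0 < topDegree γ) :
    (∃ j, pyramid γ j = 0) ↔ ∃ j, γ j = 0 := by
  simp [Fin.exists_fin_succ, pyramid, funext_iff, Fin.forall_fin_succ, hD.ne']

lemma meetsAxis_pyramid (hγ : ∀ i, MeetsAxis γ i) (i : Fin (n + 1)) :
    MeetsAxis (pyramid γ) i := by
  cases i using Fin.cases with
  | zero => exact ⟨0, by simp [pyramid, Fin.forall_fin_succ]⟩
  | succ i =>
    obtain ⟨j, hj⟩ := hγ i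
    exact ⟨j.succ, by simpa [pyramid, Fin.forall_fin_succ] using hj⟩

lemma HasTopExp.symm {i k : Fin n} (h : HasTopExp γ i k) : HasTopExp γ k i := by
  obtain ⟨j, hj, hsupp⟩ := h
  exact ⟨j, hj, fun m hmk hmi => hsupp m hmi hmk⟩

lemma hasTopExp_pyramid_zero (i : Fin (n + 1)) : HasTopExp (pyramid γ) 0 i :=
  ⟨0, by rw [topDegree_pyramid]; simp [pyramid, Fin.sum_univ_succ],
    by simp [pyramid, Fin.forall_fin_succ]⟩

lemma hasTopExp_pyramid_succ_iff (hD : 0 < topDegree γ) (i k : Fin n) :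
    HasTopExp (pyramid γ) i.succ k.succ ↔ HasTopExp γ i k := by
  rw [HasTopExp, HasTopExp, topDegree_pyramid]
  simp [Fin.exists_fin_succ (n := r + 1), pyramid, Fin.forall_fin_succ, Fin.sum_univ_succ, hD.ne',
    (Fin.succ_ne_zero _).symm]

lemma bareDirections_pyramid (hD : 0 < topDegree γ) :
    bareDirections (pyramid γ) = (bareDirections γ).map (Fin.succEmb n) := by
  ext i
  cases i using Fin.cases <;>
    simp [mem_bareDirections, hasTopExp_pyramid_zero, hasTopExp_pyramid_succ_iff hD]

lemma infinityCount_pyramid (hD : 0 < topDegree γ) :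
    infinityCount (pyramid γ) = infinityCount γ := by
  have htop : (∀ i k, i ≠ k → HasTopExp (pyramid γ) i k) ↔ ∀ i k, i ≠ k → HasTopExp γ i k := by
    simp [Fin.forall_fin_succ, hasTopExp_pyramid_zero, (hasTopExp_pyramid_zero _).symm,
      hasTopExp_pyramid_succ_iff hD]
  simp only [infinityCount, htop, bareDirections_pyramid hD, Finset.card_map]

end Pyramid

lemma IsModel.pyramid {C : Prop} {k : ℕ∞} (hn : 0 < n) (h : IsModel γ C k) :
    IsModel (pyramid γ) C k :=
  have hD := topDegree_pos hn h.affineIndependent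
  ⟨affineIndependent_pyramid hD h.affineIndependent,
    (exists_pyramid_eq_zero_iff hD).trans h.exists_eq_zero_iff, meetsAxis_pyramid h.meetsAxis,
    (infinityCount_pyramid hD).trans h.infinityCount_eq⟩

lemma IsModel.exists_of_le {n₀ : ℕ} (hpos : 0 < n₀) (hn : n₀ ≤ n) {C : Prop} {k : ℕ∞}
    {γ₀ : Fin (n₀ + 1) → Fin n₀ → ℕ} (h : IsModel γ₀ C k) :
    ∃ γ : Fin (n + 1) → Fin n → ℕ, IsModel γ C k := by
  induction n, hn using Nat.le_induction with
  | base => exact ⟨γ₀, h⟩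
  | succ n hn ih =>
    obtain ⟨γ, hγ⟩ := ih
    exact ⟨_, hγ.pyramid (by lia)⟩

/-! ### Explicit simplices -/

lemma affineIndependent_of_det_ne_zero
    (hdet : (Matrix.of fun j => (Fin.cons 1 fun i => (γ j i : ℤ) : Fin (n + 1) → ℤ)).det ≠ 0) :
    AffineIndependent ℝ fun j i => (γ j i : ℝ) := by
  rw [affineIndependent_iff_forall_sum_mul_eq_zero]
  intro u hu hs
  set A := Matrix.of fun j => (Fin.cons 1 fun i => (γ j i : ℤ) : Fin (n + 1) → ℤ)
  have hA : (A.map (Int.castRingHom ℝ)).det ≠ 0 := by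
    rw [← RingHom.mapMatrix_apply, ← RingHom.map_det]
    simpa using hdet
  refine Matrix.eq_zero_of_vecMul_eq_zero hA (funext fun i => ?_)
  cases i using Fin.cases with
  | zero => simpa [A, Matrix.vecMul, dotProduct] using hu
  | succ i => simpa [A, Matrix.vecMul, dotProduct] using hs i

lemma isModel_of_det_ne_zero {C : Prop} {k : ℕ}
    (hdet : (Matrix.of fun j => (Fin.cons 1 fun i => (γ j i : ℤ) : Fin (n + 1) → ℤ)).det ≠ 0)
    (hC : (∃ j, γ j = 0) ↔ C) (haxis : ∀ i, MeetsAxis γ i)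
    (htop : ∀ i k, i ≠ k → HasTopExp γ i k) (hk : (bareDirections γ).card = k) :
    IsModel γ C k :=
  ⟨affineIndependent_of_det_ne_zero hdet, hC, haxis, by rw [infinityCount, if_pos htop, hk]⟩

lemma exists_triangle_with_origin {k : ℕ} (hk : k ≤ 2) :
    ∃ γ : Fin (2 + 1) → Fin 2 → ℕ, IsModel γ True k ∧ ∃ i, Odd (γ 1 i + γ 2 i) := by
  interval_cases k
  · exact ⟨![![0, 0], ![1, 0], ![0, 1]], by apply isModel_of_det_ne_zero <;> decide, by decide⟩
  · exact ⟨![![0, 0], ![2, 0], ![0, 1]], by apply isModel_of_det_ne_zero <;> decide, by decide⟩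
  · exact ⟨![![0, 0], ![1, 1], ![1, 0]], by apply isModel_of_det_ne_zero <;> decide, by decide⟩

lemma exists_triangle_without_origin {k : ℕ} (hk : k ≤ 2) :
    ∃ γ : Fin (2 + 1) → Fin 2 → ℕ, IsModel γ False k ∧ ∃ i, Odd (γ 1 i + γ 2 i) := by
  interval_cases k
  · exact ⟨![![2, 0], ![0, 2], ![1, 0]], by apply isModel_of_det_ne_zero <;> decide, by decide⟩
  · exact ⟨![![1, 0], ![2, 0], ![0, 1]], by apply isModel_of_det_ne_zero <;> decide, by decide⟩
  · exact ⟨![![1, 1], ![1, 0], ![0, 1]], by apply isModel_of_det_ne_zero <;> decide, by decide⟩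

lemma exists_isModel_with_origin (hn : 2 < n) {k : ℕ} (hk : k ≤ 3) :
    ∃ γ : Fin (n + 1) → Fin n → ℕ, IsModel γ True k := by
  rcases Nat.le_succ_iff.1 hk with hk | rfl
  · obtain ⟨γ, hγ, -⟩ := exists_triangle_with_origin hk
    exact hγ.exists_of_le two_pos hn.le
  · exact IsModel.exists_of_le (γ₀ := ![![0, 0, 0], ![1, 1, 0], ![0, 1, 1], ![1, 0, 1]])
      three_pos hn (by apply isModel_of_det_ne_zero <;> decide)

lemma exists_isModel_without_origin (hn : 2 < n) {k : ℕ} (hk : k ≤ 2) :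
    ∃ γ : Fin (n + 1) → Fin n → ℕ, IsModel γ False k := by
  obtain ⟨γ, hγ, -⟩ := exists_triangle_without_origin hk
  exact hγ.exists_of_le two_pos hn.le

lemma exists_isModel_with_origin_top (hn : 2 < n) :
    ∃ γ : Fin (n + 1) → Fin n → ℕ, IsModel γ True ⊤ :=
  IsModel.exists_of_le (γ₀ := ![![0, 0, 0], ![2, 0, 0], ![0, 1, 0], ![0, 0, 1]]) three_pos hn
    ⟨affineIndependent_of_det_ne_zero (by decide), by decide, by decide, if_neg (by decide)⟩

lemma exists_isModel_without_origin_top (hn : 2 < n) :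
    ∃ γ : Fin (n + 1) → Fin n → ℕ, IsModel γ False ⊤ :=
  IsModel.exists_of_le (γ₀ := ![![2, 0, 0], ![1, 0, 0], ![0, 1, 0], ![0, 0, 1]]) three_pos hn
    ⟨affineIndependent_of_det_ne_zero (by decide), by decide, by decide, if_neg (by decide)⟩

/-! ### Occurrence of all cases -/

lemma Occurs.mono {Q Q' : ℕ → MvPolynomial (Fin n) ℝ → (Fin n →₀ ℕ) → Prop} (h : Occurs n Q)
    (hQ : ∀ d f β, Q d f β → Q' d f β) : Occurs n Q' := by
  obtain ⟨d, f, r, α, β, hf, hfull, hQf⟩ := h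
  exact ⟨d, f, r, α, β, hf, hfull, hQ d f β hQf⟩

lemma IsModel.occurs {C : Prop} {k : ℕ∞} (hn : 0 < n) (h : IsModel γ C k) :
    Occurs n fun d f _ => (HasConstantTerm f ↔ C) ∧ (affineZeros f).Finite ∧
      (zerosAtInfinity (homogenization d f)).encard = k :=
  (occurs_isEvenExp hn h.affineIndependent fun _ _ _ _ hM hf =>
    ⟨h.hasConstantTerm_iff hM hf, h.finite_affineZeros hM hf,
      h.encard_zerosAtInfinity hM hf⟩).mono fun _ _ _ hQ => hQ.2

theorem occurs_hasConstantTerm_finite (hn : 2 < n) {k : ℕ} (hk : k ≤ 3) :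
    Occurs n fun d f _ => HasConstantTerm f ∧ (affineZeros f).Finite ∧
      (zerosAtInfinity (homogenization d f)).encard = k := by
  obtain ⟨γ, hγ⟩ := exists_isModel_with_origin hn hk
  simpa using hγ.occurs (by lia)

theorem occurs_hasConstantTerm_infinite (hn : 2 < n) :
    Occurs n fun d f _ => HasConstantTerm f ∧ (affineZeros f).Finite ∧
      (zerosAtInfinity (homogenization d f)).Infinite := by
  obtain ⟨γ, hγ⟩ := exists_isModel_with_origin_top hn
  simpa using hγ.occurs (by lia)

theorem occurs_not_hasConstantTerm_finite (hn : 2 < n) {k : ℕ} (hk : k ≤ 2) :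
    Occurs n fun d f _ => ¬ HasConstantTerm f ∧ (affineZeros f).Finite ∧
      (zerosAtInfinity (homogenization d f)).encard = k := by
  obtain ⟨γ, hγ⟩ := exists_isModel_without_origin hn hk
  simpa using hγ.occurs (by lia)

theorem occurs_not_hasConstantTerm_infinite (hn : 2 < n) :
    Occurs n fun d f _ => ¬ HasConstantTerm f ∧ (affineZeros f).Finite ∧
      (zerosAtInfinity (homogenization d f)).Infinite := by
  obtain ⟨γ, hγ⟩ := exists_isModel_without_origin_top hn
  simpa using hγ.occurs (by lia)

theorem bivariate_occurs_hasConstantTerm {k : ℕ} (hk : k ≤ 2) :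
    Occurs 2 (fun d f β => HasConstantTerm f ∧ IsEvenExp β ∧
      (projZeros (homogenization d f)).encard = 4 + k) ∧
    Occurs 2 (fun d f β => HasConstantTerm f ∧ ¬ IsEvenExp β ∧
      (projZeros (homogenization d f)).encard = 2 + k) := by
  obtain ⟨γ, hγ, hodd⟩ := exists_triangle_with_origin hk
  have hcount : ∀ M d f β, 0 < M → IsBoundaryCircuit d f 2 (dilate M γ) β →
      HasConstantTerm f ∧ (projZeros (homogenization d f)).encard = orthantCount β + k :=
    fun M d f β hM hf => ⟨(hγ.hasConstantTerm_iff hM hf).2 trivial, by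
      rw [encard_projZeros hf.degree.le, hγ.encard_affineZeros_of_true hM hf,
        hγ.encard_zerosAtInfinity hM hf]⟩
  constructor
  · refine (occurs_isEvenExp two_pos hγ.affineIndependent hcount).mono ?_
    rintro d f β ⟨hβ, hconst, hproj⟩
    exact ⟨hconst, hβ, by simpa [orthantCount, hβ] using hproj⟩
  · refine (occurs_not_isEvenExp hγ.affineIndependent hodd hcount).mono ?_
    rintro d f β ⟨hβ, hconst, hproj⟩
    exact ⟨hconst, hβ, by simpa [orthantCount, hβ] using hproj⟩

theorem bivariate_occurs_not_hasConstantTerm {k : ℕ} (hk : k ≤ 2) :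
    Occurs 2 (fun d f β => ¬ HasConstantTerm f ∧ IsEvenExp β ∧
      (projZeros (homogenization d f)).encard = 5 + k) ∧
    Occurs 2 (fun d f β => ¬ HasConstantTerm f ∧ ¬ IsEvenExp β ∧
      (projZeros (homogenization d f)).encard = 3 + k) := by
  obtain ⟨γ, hγ, hodd⟩ := exists_triangle_without_origin hk
  have hcount : ∀ M d f β, 0 < M → IsBoundaryCircuit d f 2 (dilate M γ) β →
      ¬ HasConstantTerm f ∧
        (projZeros (homogenization d f)).encard = (orthantCount β + 1 : ℕ) + k :=
    fun M d f β hM hf => ⟨mt (hγ.hasConstantTerm_iff hM hf).1 not_false, by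
      rw [encard_projZeros hf.degree.le, hγ.encard_affineZeros_of_false hM hf,
        hγ.encard_zerosAtInfinity hM hf, Nat.cast_add_one]⟩
  constructor
  · refine (occurs_isEvenExp two_pos hγ.affineIndependent hcount).mono ?_
    rintro d f β ⟨hβ, hconst, hproj⟩
    exact ⟨hconst, hβ, by simpa [orthantCount, hβ] using hproj⟩
  · refine (occurs_not_isEvenExp hγ.affineIndependent hodd hcount).mono ?_
    rintro d f β ⟨hβ, hconst, hproj⟩
    exact ⟨hconst, hβ, by simpa [orthantCount, hβ] using hproj⟩

theorem bivariate_occurs_infinite_affineZeros :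
    Occurs 2 (fun _ f β => ¬ HasConstantTerm f ∧ IsEvenExp β ∧ (affineZeros f).Infinite) ∧
    Occurs 2 (fun _ f β => ¬ HasConstantTerm f ∧ ¬ IsEvenExp β ∧ (affineZeros f).Infinite) := by
  let γ : Fin (2 + 1) → Fin 2 → ℕ := ![![1, 0], ![2, 0], ![1, 1]]
  have hγ : AffineIndependent ℝ fun j i => (γ j i : ℝ) :=
    affineIndependent_of_det_ne_zero (by decide)
  have hzeros : ∀ M d f β, 0 < M → IsBoundaryCircuit d f 2 (dilate M γ) β →
      ¬ HasConstantTerm f ∧ (affineZeros f).Infinite := fun M d f β hM hf =>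
    ⟨by simpa only [hf.hasConstantTerm_iff, dilate_eq_zero_iff hM] using
        (by decide : ¬ ∃ j, γ j = 0),
      hf.infinite_affineZeros_of_not_meetsAxis (i := 1)
        ((meetsAxis_dilate_iff hM).not.2 (by decide))⟩
  exact ⟨(occurs_isEvenExp two_pos hγ hzeros).mono fun _ _ _ h => and_left_comm.1 h,
    (occurs_not_isEvenExp hγ (by decide) hzeros).mono fun _ _ _ h => and_left_comm.1 h⟩

end LatticeSimplices

end CircuitZeros

end

open CircuitZeros in
theorem mainTheorem2 :
    -- bivariate case
    (∀ (d : ℕ) (f : MvPolynomial (Fin 2) ℝ) (r : ℕ) (α : Fin (r + 1) → Fin 2 →₀ ℕ)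
        (β : Fin 2 →₀ ℕ), IsBoundaryCircuit d f r α β →
      -- with a constant term
      (HasConstantTerm f → ¬ IsDegenerate f →
        (IsEvenExp β → (affineZeros f).encard = 4 ∧
          (projZeros (homogenization d f)).encard ∈ ({4, 5, 6} : Set ℕ∞)) ∧
        (¬ IsEvenExp β → (affineZeros f).encard = 2 ∧
          (projZeros (homogenization d f)).encard ∈ ({2, 3, 4} : Set ℕ∞))) ∧
      -- without a constant term
      (¬ HasConstantTerm f →
        (IsEvenExp β →
          ((affineZeros f).encard = 5 ∧
            (projZeros (homogenization d f)).encard ∈ ({5, 6, 7} : Set ℕ∞)) ∨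
          ((affineZeros f).encard = ⊤ ∧ (projZeros (homogenization d f)).encard = ⊤)) ∧
        (¬ IsEvenExp β →
          ((affineZeros f).encard = 3 ∧
            (projZeros (homogenization d f)).encard ∈ ({3, 4, 5} : Set ℕ∞)) ∨
          ((affineZeros f).encard = ⊤ ∧ (projZeros (homogenization d f)).encard = ⊤))) ∧
      -- at most two zeros at infinity
      ((affineZeros f).Finite → (zerosAtInfinity (homogenization d f)).encard ≤ 2)) ∧
    -- all the cases of the bivariate case occur
    (∀ k : ℕ, k ≤ 2 →
      Occurs 2 (fun d f β => HasConstantTerm f ∧ IsEvenExp β ∧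
        (projZeros (homogenization d f)).encard = 4 + k) ∧
      Occurs 2 (fun d f β => HasConstantTerm f ∧ ¬ IsEvenExp β ∧
        (projZeros (homogenization d f)).encard = 2 + k) ∧
      Occurs 2 (fun d f β => ¬ HasConstantTerm f ∧ IsEvenExp β ∧
        (projZeros (homogenization d f)).encard = 5 + k) ∧
      Occurs 2 (fun d f β => ¬ HasConstantTerm f ∧ ¬ IsEvenExp β ∧
        (projZeros (homogenization d f)).encard = 3 + k)) ∧
    Occurs 2 (fun _ f β => ¬ HasConstantTerm f ∧ IsEvenExp β ∧ (affineZeros f).Infinite) ∧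
    Occurs 2 (fun _ f β => ¬ HasConstantTerm f ∧ ¬ IsEvenExp β ∧ (affineZeros f).Infinite) ∧
    -- general case
    (∀ n : ℕ, 2 < n →
      (∀ (d : ℕ) (f : MvPolynomial (Fin n) ℝ) (r : ℕ) (α : Fin (r + 1) → Fin n →₀ ℕ)
          (β : Fin n →₀ ℕ), IsBoundaryCircuit d f r α β →
        (projZeros (homogenization d f)).encard =
          (affineZeros f).encard + (zerosAtInfinity (homogenization d f)).encard ∧
        (HasConstantTerm f →
          (zerosAtInfinity (homogenization d f)).encard ≤ 3 ∨
          (zerosAtInfinity (homogenization d f)).Infinite) ∧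
        (¬ HasConstantTerm f →
          (zerosAtInfinity (homogenization d f)).encard ≤ 2 ∨
          (zerosAtInfinity (homogenization d f)).Infinite ∨
          (affineZeros f).Infinite)) ∧
      -- all the cases of the general case occur
      (∀ k : ℕ, k ≤ 3 → Occurs n (fun d f _ => HasConstantTerm f ∧ (affineZeros f).Finite ∧
        (zerosAtInfinity (homogenization d f)).encard = k)) ∧
      Occurs n (fun d f _ => HasConstantTerm f ∧ (affineZeros f).Finite ∧
        (zerosAtInfinity (homogenization d f)).Infinite) ∧
      (∀ k : ℕ, k ≤ 2 → Occurs n (fun d f _ => ¬ HasConstantTerm f ∧ (affineZeros f).Finite ∧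
        (zerosAtInfinity (homogenization d f)).encard = k)) ∧
      Occurs n (fun d f _ => ¬ HasConstantTerm f ∧ (affineZeros f).Finite ∧
        (zerosAtInfinity (homogenization d f)).Infinite)) := by
  refine ⟨fun d f r α β hf => ⟨hf.bivariate_zeros_of_hasConstantTerm,
      hf.bivariate_zeros_of_not_hasConstantTerm, hf.encard_zerosAtInfinity_le_two⟩,
    fun k hk => ?_, bivariate_occurs_infinite_affineZeros.1,
    bivariate_occurs_infinite_affineZeros.2, fun n hn => ⟨fun d f r α β hf => ?_,
      fun k => occurs_hasConstantTerm_finite hn, occurs_hasConstantTerm_infinite hn,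
      fun k => occurs_not_hasConstantTerm_finite hn, occurs_not_hasConstantTerm_infinite hn⟩⟩
  · have hconst := bivariate_occurs_hasConstantTerm hk
    have hnot := bivariate_occurs_not_hasConstantTerm hk
    exact ⟨hconst.1, hconst.2, hnot.1, hnot.2⟩
  · exact ⟨encard_projZeros hf.degree.le, hf.encard_zerosAtInfinity_le_three_or_infinite,
      hf.encard_zerosAtInfinity_le_two_or_infinite⟩
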